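/- Let $X$ be a complex Banach space and let $A:D(A)\to X$ be the generator of a strongly continuous semigroup $(K(t))_{t\ge 0}$ on $X$ with $\|K(t)\|\le M$ for all $t\ge 0$, where $M\ge 1$; write $R_A(z)=(z-A)^{-1}$ and $\exp(At)=K(t)$. Let $m\ge 2$ be an even integer, $\delta>0$, $h>0$, $t>0$, let $x\in D(A^m)$, put $y=(2\delta-A)^m x$ and $r(z)=(2\delta-z)^{-m}$, and for $u\in X$, $s\in\mathbb{R}$ let $$f_u(s)=r(\delta+is)\,e^{(\delta+is)t}\,R_A(\delta+is)\,u .$$ Put $$I=\frac1{2\pi}\int_{-\infty}^{\infty} f_y(s)\,ds,\qquad S_h=\frac{h}{2\pi}\sum_{k=-\infty}^{\infty}f_y(hk),\qquad S_h^N=\frac{h}{2\pi}\sum_{k=-N}^{N}f_y(hk),$$ and let the $m$-th order trapezoidal approximation of $\exp(At)x$ be $$X_{h,N}=(2\delta-A)^m\Big[\frac{h}{2\pi}\sum_{k=-N}^{N}\frac{e^{(\delta+ihk)t}}{(\delta-ihk)^m}R_A(\delta+ihk)\,x\Big].$$ Then every $z$ with $\operatorname{Re}z>0$ belongs to the resolvent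 set of $A$, the integral and the series above converge absolutely, and $\exp(At)x=I$. For every integer $N\ge1$ the bracketed vector belongs to $D(A^m)$, $X_{h,N}=S_h^N$, and $$\|\exp(At)x-X_{h,N}\|\le E_{\rm D}+E_{\rm T},\qquad E_{\rm D}=\|I-S_h\|,\quad E_{\rm T}=\|S_h-S_h^N\|,$$ where the discretization error satisfies $$E_{\rm D}\le \frac{M e^{3\delta t/2}}{\delta^m(e^{\delta\pi/h}-1)}\left[\frac{2^{m+1}\Gamma(\frac32)\Gamma(\frac{m-1}2)}{\pi\,\Gamma(\frac m2)}\right]\|(2\delta-A)^m x\|$$ and the truncation error satisfies $$E_{\rm T}\le \frac{M e^{\delta t}}{\delta^m}\left[\frac{\Gamma(\frac32)\Gamma(\frac{m-1}2)}{\pi\,\Gamma(\frac m2)}-\frac{hN}{\pi\delta}\,{}_2F_1\!\left(\tfrac12,\tfrac m2;\tfrac32;-\Big(\frac{hN}{\delta}\Big)^2\right)\right]\|(2\delta-A)^m x\| .$$ Here ${}_2F_1$ is the principal branch of the hypergeometric function, i.e. the analytic continuation of the hypergeometric series to $\mathbb{C}\setminus[1,\infty)$. Moreover, as $N\to\infty$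 with all other parameters fixed, the bound on $E_{\rm T}$ is asymptotically equivalent to $$\frac{M e^{\delta t}}{\pi\delta^m}\left[\frac1{m-1}\Big(\frac{\delta}{hN}\Big)^{m-1}\right]\|(2\delta-A)^m x\| ,$$ and hence $E_{\rm T}=O(N^{-(m-1)})$. -/

import Mathlib

open Filter Topology MeasureTheory Asymptotics

noncomputable section

/-! ### Strongly continuous semigroups, generators, resolvents -/

/-- `(K t)_{t ≥ 0}` is a strongly continuous semigroup of bounded operators on `X`.
Only the values of `K` at `t ≥ 0` matter. -/
structure IsC0Semigroup {X : Type*} [NormedAddCommGroup X] [NormedSpace ℂ X]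
    (K : ℝ → X →L[ℂ] X) : Prop where
  map_zero : K 0 = ContinuousLinearMap.id ℂ X
  map_add : ∀ s t : ℝ, 0 ≤ s → 0 ≤ t → K (s + t) = (K s).comp (K t)
  continuous_orbit : ∀ x : X, ContinuousOn (fun t : ℝ => K t x) (Set.Ici 0)

/-- The partially defined operator `A` is the generator of the semigroup `K`: `x ∈ D(A)` and
`A x = y` exactly when `(K t x - x) / t → y` as `t → 0+`. -/
def IsGeneratorOf {X : Type*} [NormedAddCommGroup X] [NormedSpace ℂ X]
    (A : X →ₗ.[ℂ] X) (K : ℝ → X →L[ℂ] X) : Prop :=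
  ∀ x y : X, (x, y) ∈ A.graph ↔
    Tendsto (fun t : ℝ => ((t : ℂ)⁻¹) • (K t x - x)) (𝓝[>] 0) (𝓝 y)

/-- The growth bound `‖K t‖ ≤ M e^{ω t}` for all `t ≥ 0`. -/
def HasGrowthBound {X : Type*} [NormedAddCommGroup X] [NormedSpace ℂ X]
    (K : ℝ → X →L[ℂ] X) (M ω : ℝ) : Prop :=
  ∀ t : ℝ, 0 ≤ t → ‖K t‖ ≤ M * Real.exp (ω * t)

/-- The operator `z - A : D(A) → X`. -/
def shiftOp {X : Type*} [NormedAddCommGroup X] [NormedSpace ℂ X]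
    (A : X →ₗ.[ℂ] X) (z : ℂ) (u : A.domain) : X :=
  z • (u : X) - A u

/-- The resolvent set `ρ(A)`: all `z` for which `z - A : D(A) → X` is bijective. -/
def opResolventSet {X : Type*} [NormedAddCommGroup X] [NormedSpace ℂ X]
    (A : X →ₗ.[ℂ] X) : Set ℂ :=
  {z | Function.Bijective (shiftOp A z)}

/-- The resolvent `R_A(z) y = (z - A)⁻¹ y` (meaningful for `z ∈ ρ(A)`). -/
def opResolvent {X : Type*} [NormedAddCommGroup X] [NormedSpace ℂ X]
    (A : X →ₗ.[ℂ] X) (z : ℂ) (y : X) : X :=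
  ((Function.invFun (shiftOp A z) y : A.domain) : X)

open Classical in
/-- `A x` for `x ∈ D(A)`, and `0` otherwise. -/
def opApply {X : Type*} [NormedAddCommGroup X] [NormedSpace ℂ X]
    (A : X →ₗ.[ℂ] X) (x : X) : X :=
  if hx : x ∈ A.domain then A ⟨x, hx⟩ else 0

/-- The domain `D(A^m)`. -/
def powDomain {X : Type*} [NormedAddCommGroup X] [NormedSpace ℂ X]
    (A : X →ₗ.[ℂ] X) : ℕ → Set X
  | 0 => Set.univ
  | m + 1 => {x | x ∈ A.domain ∧ opApply A x ∈ powDomain A m}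

/-- `(z - A)^m x` (meaningful for `x ∈ D(A^m) = D((z - A)^m)`). -/
def shiftPow {X : Type*} [NormedAddCommGroup X] [NormedSpace ℂ X]
    (A : X →ₗ.[ℂ] X) (z : ℂ) : ℕ → X → X
  | 0, x => x
  | m + 1, x => shiftPow A z m (z • x - opApply A x)

/-! ### The regularized contour integral and its trapezoidal approximations -/

/-- The point `δ + i s` of the vertical contour. -/
def contourPoint (δ s : ℝ) : ℂ := (δ : ℂ) + Complex.I * (s : ℂ)

/-- The regularizer `r(z) = (2δ - z)^{-m}`. -/
def regularizer (δ : ℝ) (m : ℕ) (z : ℂ) : ℂ := ((2 * (δ : ℂ) - z) ^ m)⁻¹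

/-- The integrand `r(z) e^{z t} R_A(z) y` at `z = δ + i s`. -/
def contourIntegrand {X : Type*} [NormedAddCommGroup X] [NormedSpace ℂ X]
    (A : X →ₗ.[ℂ] X) (δ t : ℝ) (m : ℕ) (y : X) (s : ℝ) : X :=
  (regularizer δ m (contourPoint δ s) * Complex.exp (contourPoint δ s * (t : ℂ))) •
    opResolvent A (contourPoint δ s) y

/-- The contour integral `(2πi)⁻¹ ∫_{δ-i∞}^{δ+i∞} r(z) e^{zt} R_A(z) y dz`, parametrized by
`z = δ + i s`. -/
def contourIntegral {X : Type*} [NormedAddCommGroup X] [NormedSpace ℂ X]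
    (A : X →ₗ.[ℂ] X) (δ t : ℝ) (m : ℕ) (y : X) : X :=
  (1 / (2 * Real.pi)) • ∫ s : ℝ, contourIntegrand A δ t m y s

/-- The infinite trapezoidal sum with node spacing `h`. -/
def trapSeries {X : Type*} [NormedAddCommGroup X] [NormedSpace ℂ X]
    (A : X →ₗ.[ℂ] X) (δ t h : ℝ) (m : ℕ) (y : X) : X :=
  (h / (2 * Real.pi)) • ∑' k : ℤ, contourIntegrand A δ t m y (h * (k : ℝ))

/-- The truncated trapezoidal sum over the `2N + 1` nodes `δ + i h k`, `-N ≤ k ≤ N`. -/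
def trapSum {X : Type*} [NormedAddCommGroup X] [NormedSpace ℂ X]
    (A : X →ₗ.[ℂ] X) (δ t h : ℝ) (m N : ℕ) (y : X) : X :=
  (h / (2 * Real.pi)) •
    ∑ k ∈ Finset.Icc (-(N : ℤ)) (N : ℤ), contourIntegrand A δ t m y (h * (k : ℝ))

/-- The `m`-th order trapezoidal approximation of `exp(A t) x`:
`(2δ - A)^m [ (h / 2π) ∑_{k=-N}^{N} e^{(δ + ihk) t} (δ - ihk)^{-m} R_A(δ + ihk) x ]`. -/
def trapApprox {X : Type*} [NormedAddCommGroup X] [NormedSpace ℂ X]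
    (A : X →ₗ.[ℂ] X) (δ t h : ℝ) (m N : ℕ) (x : X) : X :=
  shiftPow A (2 * (δ : ℂ)) m (trapSum A δ t h m N x)

/-! ### The hypergeometric function and the error bounds -/

/-- `F` is the principal branch of the Gauss hypergeometric function with parameters `a, b, c`:
it is analytic on `ℂ ∖ [1, ∞)` and is given by the hypergeometric series on the unit disk
(Mathlib's `ordinaryHypergeometric` is the sum of that series, hence meaningless
for `‖z‖ > 1`). -/
def IsHypergeometricBranch (a b c : ℂ) (F : ℂ → ℂ) : Prop :=
  AnalyticOnNhd ℂ F {z | 1 - z ∈ Complex.slitPlane} ∧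
    ∀ z : ℂ, ‖z‖ < 1 → F z = ordinaryHypergeometric a b c z

open Classical in
/-- The principal branch of the hypergeometric function `₂F₁(a, b; c; z)` on `ℂ ∖ [1, ∞)`,
i.e. the (unique) analytic continuation of the hypergeometric series. -/
def hypergeometricFn (a b c z : ℂ) : ℂ :=
  if h : ∃ F : ℂ → ℂ, IsHypergeometricBranch a b c F then h.choose z else 0

/-- The real value `₂F₁(a, b; c; x)` for real parameters and real `x < 1`. -/
def hypergeometricReal (a b c x : ℝ) : ℝ := (hypergeometricFn a b c x).re

/-- The bound on the discretization error, with `Y` in place of `‖(2δ - A)^m x‖`. -/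
def discretizationBound (M δ t h : ℝ) (m : ℕ) (Y : ℝ) : ℝ :=
  M * Real.exp (3 * δ * t / 2) / (δ ^ m * (Real.exp (δ * Real.pi / h) - 1)) *
    (2 ^ (m + 1) * Real.Gamma (3 / 2) * Real.Gamma (((m : ℝ) - 1) / 2) /
      (Real.pi * Real.Gamma ((m : ℝ) / 2))) * Y

/-- The bound on the truncation error, with `Y` in place of `‖(2δ - A)^m x‖`. -/
def truncationBound (M δ t h : ℝ) (m N : ℕ) (Y : ℝ) : ℝ :=
  M * Real.exp (δ * t) / δ ^ m *
    (Real.Gamma (3 / 2) * Real.Gamma (((m : ℝ) - 1) / 2) / (Real.pi * Real.Gamma ((m : ℝ) / 2)) -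
      h * (N : ℝ) / (Real.pi * δ) *
        hypergeometricReal (1 / 2) ((m : ℝ) / 2) (3 / 2) (-(h * (N : ℝ) / δ) ^ 2)) * Y

end

/-! Everything reduces to scalar integrals tested against the orbit `τ ↦ K τ y`. On the right
half-plane the resolvent is the Laplace transform of the semigroup, so by Fubini both the contour
integral and the trapezoidal series become ∫₀^∞ κ(t - τ) K(τ)y dτ, where κ(v) is the integral,
respectively the trapezoidal series, of the scalar function r(z)e^{zv}.

Write m = 2(k+1). By Fourier inversion the scalar integral is e^{δv} g(-v), with g(σ) = σ₊^{m-1}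
e^{-δσ}/(m-1)!. At v = t - τ this is supported in τ > t, and the semigroup law turns the integral
into K(t) applied to (2δ - A)^{-m} y = x. This is the representation exp(At)x = I.

Poisson summation turns the scalar series into e^{δv} Σₙ g(-v + 2πn/h). The term n = 0 is the
integral, so the discretization error consists of the terms n ≠ 0. Half of the exponential decay of
g bounds the kernel uniformly, the other half makes the remaining terms a geometric series with sum
1/(e^{δπ/h} - 1); integrating in τ against ‖K(τ)y‖ ≤ M‖y‖ gives the bound.

The truncation error is a sum of norms: ‖f_y(s)‖ is at most a constant times (δ² + s²)^{-m/2}, which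
decreases in |s|, so the omitted nodes are dominated by the tail integral from hN. Euler's integral
identifies that tail with the bracket of Gamma and ₂F₁ values, and comparison with u^{-m} gives its
asymptotics. -/

/-! ### The principal branch of ₂F₁(1/2, p; 3/2; ·) as an Euler integral -/

theorem hypergeometricFn_eq_of_isBranch {a b c : ℂ} {F : ℂ → ℂ}
    (hF : IsHypergeometricBranch a b c F) {z : ℂ} (hz : 1 - z ∈ Complex.slitPlane) :
    hypergeometricFn a b c z = F z := by
  have hex : ∃ F : ℂ → ℂ, IsHypergeometricBranch a b c F := ⟨F, hF⟩
  have hG : IsHypergeometricBranch a b c hex.choose := hex.choose_spec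
  rw [hypergeometricFn, dif_pos hex]
  -- The cut plane is star-shaped about 0, hence connected, so the identity theorem makes the branch
  -- unique and the chosen one equals `F`.
  have hstar : StarConvex ℝ (0 : ℂ) {z : ℂ | 1 - z ∈ Complex.slitPlane} := by
    intro w hw r s hr hs hrs
    have := Complex.starConvex_one_slitPlane hw hr hs hrs
    simp only [Set.mem_ofPred_eq] at this ⊢
    convert this using 1
    have : (s : ℂ) = 1 - r := by
      rw [eq_sub_iff_add_eq, add_comm]; exact_mod_cast hrs
    simp [Complex.real_smul, this]
    ring
  refine hG.1.eqOn_of_preconnected_of_eventuallyEq hF.1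
    (hstar.isPathConnected (by simp)).isConnected.isPreconnected
    (z₀ := 0) (by simp) ?_ hz
  filter_upwards [Metric.ball_mem_nhds (0 : ℂ) one_pos] with w hw
  have hw' : ‖w‖ < 1 := by simpa using hw
  rw [hG.2 w hw', hF.2 w hw']

/-- Euler's integral for `₂F₁(1/2, p; 3/2; z)`. -/
noncomputable def eulerIntegral (p : ℕ) (z : ℂ) : ℂ :=
  ∫ v in (0 : ℝ)..1, ((1 - z * (v : ℂ) ^ 2) ^ p)⁻¹

/-- 1 - zv² is a convex combination of 1 and 1 - z, and the slit plane is star-shaped about 1. -/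
theorem one_sub_mul_sq_ne_zero {z : ℂ} (hz : 1 - z ∈ Complex.slitPlane) {v : ℝ}
    (hv : v ∈ Set.Icc (0 : ℝ) 1) : 1 - z * (v : ℂ) ^ 2 ≠ 0 := by
  intro h
  have hv2 : v ^ 2 ≤ 1 := by nlinarith [hv.1, hv.2]
  have := Complex.starConvex_one_slitPlane hz (a := 1 - v ^ 2) (b := v ^ 2)
    (by linarith) (by positivity) (by ring)
  have h0 : (1 - v ^ 2 : ℝ) • (1 : ℂ) + (v ^ 2 : ℝ) • (1 - z) = 0 := by
    rw [Complex.real_smul, Complex.real_smul, ← h]; push_cast; ring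
  rw [h0] at this
  exact Complex.slitPlane_ne_zero this rfl

/-- Differentiation under the integral sign; the `z`-derivative is continuous, hence bounded, on the
compact product of a small closed disk with [0, 1]. -/
theorem eulerIntegral_differentiableAt (p : ℕ) {z₀ : ℂ} (hz : 1 - z₀ ∈ Complex.slitPlane) :
    DifferentiableAt ℂ (eulerIntegral p) z₀ := by
  have hopen : IsOpen {z : ℂ | 1 - z ∈ Complex.slitPlane} :=
    Complex.isOpen_slitPlane.preimage (by fun_prop)
  obtain ⟨ε, hε, hball⟩ := Metric.nhds_basis_closedBall.mem_iff.1 (hopen.mem_nhds hz)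
  set F' : ℂ → ℝ → ℂ := fun z v =>
    -((p : ℂ) * (1 - z * (v : ℂ) ^ 2) ^ (p - 1) * (-(v : ℂ) ^ 2)) /
      ((1 - z * (v : ℂ) ^ 2) ^ p) ^ 2 with hF'
  have hne : ∀ z ∈ Metric.closedBall z₀ ε, ∀ v ∈ Set.Icc (0 : ℝ) 1,
      1 - z * (v : ℂ) ^ 2 ≠ 0 := fun z hz v hv => one_sub_mul_sq_ne_zero (hball hz) hv
  have hcont : ContinuousOn (fun q : ℂ × ℝ => F' q.1 q.2)
      (Metric.closedBall z₀ ε ×ˢ Set.Icc (0 : ℝ) 1) := by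
    refine ContinuousOn.div (by fun_prop) (by fun_prop) ?_
    rintro ⟨z, v⟩ ⟨h1, h2⟩
    exact pow_ne_zero _ (pow_ne_zero _ (hne z h1 v h2))
  obtain ⟨C, hC⟩ := ((isCompact_closedBall z₀ ε).prod isCompact_Icc).exists_bound_of_continuousOn
    hcont
  have hFc : ∀ z ∈ Metric.closedBall z₀ ε,
      ContinuousOn (fun v : ℝ => ((1 - z * (v : ℂ) ^ 2) ^ p)⁻¹) (Set.uIcc 0 1) := by
    intro z hz
    rw [Set.uIcc_of_le zero_le_one]
    exact ContinuousOn.inv₀ (by fun_prop) fun v hv => pow_ne_zero _ (hne z hz v hv)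
  have hmem : Metric.closedBall z₀ ε ∈ 𝓝 z₀ := Metric.closedBall_mem_nhds z₀ hε
  have hz₀ : z₀ ∈ Metric.closedBall z₀ ε := Metric.mem_closedBall_self hε.le
  have hI : Set.uIoc (0 : ℝ) 1 ⊆ Set.Icc 0 1 := by
    rw [Set.uIoc_of_le zero_le_one]; exact Set.Ioc_subset_Icc_self
  refine (intervalIntegral.hasDerivAt_integral_of_dominated_loc_of_deriv_le
    (F := fun z v => ((1 - z * (v : ℂ) ^ 2) ^ p)⁻¹) (F' := F') (bound := fun _ => C)
    hmem ?_ ?_ ?_ ?_ ?_ ?_).2.differentiableAt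
  · filter_upwards [hmem] with z hz
    exact ((hFc z hz).intervalIntegrable).aestronglyMeasurable_restrict_uIoc
  · exact (hFc z₀ hz₀).intervalIntegrable
  · refine ContinuousOn.aestronglyMeasurable ?_ measurableSet_uIoc
    exact (hcont.comp (f := fun v : ℝ => (z₀, v)) (by fun_prop)
      (fun v hv => ⟨hz₀, hI hv⟩))
  · exact Eventually.of_forall fun v hv z hz => hC (z, v) ⟨hz, hI hv⟩
  · exact intervalIntegrable_const
  · refine Eventually.of_forall fun v hv z hz => ?_
    have h1 : HasDerivAt (fun z : ℂ => 1 - z * (v : ℂ) ^ 2) (-(v : ℂ) ^ 2) z := by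
      simpa using ((hasDerivAt_id z).mul_const ((v : ℂ) ^ 2)).const_sub 1
    exact (h1.pow p).inv (pow_ne_zero _ (hne z hz v (hI hv)))

theorem ascPochhammer_half_ratio (n : ℕ) :
    (ascPochhammer ℂ n).eval (3 / 2) = (ascPochhammer ℂ n).eval (1 / 2) * (2 * n + 1) := by
  induction n with
  | zero => simp
  | succ n ih =>
    rw [ascPochhammer_succ_eval, ascPochhammer_succ_eval, ih]
    push_cast
    ring

theorem ascPochhammer_half_ne_zero (n : ℕ) : (ascPochhammer ℂ n).eval (1 / 2) ≠ 0 := by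
  rw [Ne, ascPochhammer_eval_eq_zero_iff]
  rintro ⟨k, -, hk⟩
  have := congrArg Complex.re hk
  simp at this
  have h0 : (0 : ℝ) ≤ k := k.cast_nonneg
  norm_num at this
  linarith

/-- The factor (1/2)ₙ/(3/2)ₙ = 1/(2n+1) is ∫₀¹ v^{2n} dv, and (k+1)ₙ/n! is a coefficient of the
binomial series of (1 - w)^{-(k+1)}. Hence the hypergeometric series is the termwise integral of
that series at w = zv². -/
theorem hypergeometric_coefficient_eq (k n : ℕ) :
    ((n.factorial : ℂ)⁻¹) * (ascPochhammer ℂ n).eval (1 / 2) *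
      (ascPochhammer ℂ n).eval ((k + 1 : ℕ) : ℂ) * ((ascPochhammer ℂ n).eval (3 / 2))⁻¹ =
      ((n + k).choose k : ℂ) / (2 * n + 1) := by
  rw [ascPochhammer_half_ratio, ← ascPochhammer_eval_cast, ascPochhammer_nat_eq_ascFactorial]
  have h1 := ascPochhammer_half_ne_zero n
  have h2 : (n.factorial : ℂ) ≠ 0 := by exact_mod_cast n.factorial_ne_zero
  have h3 : (2 * n + 1 : ℂ) ≠ 0 := by exact_mod_cast (by omega : 2 * n + 1 ≠ 0)
  have h4 : ((k + 1).ascFactorial n : ℂ) = n.factorial * ((n + k).choose k : ℂ) := by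
    rw [Nat.ascFactorial_eq_factorial_mul_choose, add_comm k n, Nat.choose_symm_add]
    push_cast; rfl
  rw [h4]
  field_simp

theorem eulerIntegral_eq_hypergeometric (k : ℕ) {z : ℂ} (hz : ‖z‖ < 1) :
    eulerIntegral (k + 1) z =
      ordinaryHypergeometric (1 / 2 : ℂ) ((k + 1 : ℕ) : ℂ) (3 / 2) z := by
  rw [ordinaryHypergeometric_eq_tsum, eulerIntegral]
  have hbound : Summable fun n : ℕ => ‖((n + k).choose k : ℂ) * z ^ n‖ :=
    (summable_choose_mul_geometric_of_norm_lt_one k hz).norm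
  have key := intervalIntegral.hasSum_integral_of_dominated_convergence (μ := volume)
    (a := 0) (b := 1) (F := fun (n : ℕ) (v : ℝ) => ((n + k).choose k : ℂ) * (z * (v : ℂ) ^ 2) ^ n)
    (f := fun v : ℝ => ((1 - z * (v : ℂ) ^ 2) ^ (k + 1))⁻¹)
    (fun n _ => ‖((n + k).choose k : ℂ) * z ^ n‖) ?_ ?_ ?_ ?_ ?_
  · rw [← key.tsum_eq]
    refine tsum_congr fun n => ?_
    have h1 : ∀ v : ℝ, ((n + k).choose k : ℂ) * (z * (v : ℂ) ^ 2) ^ n =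
        (((n + k).choose k : ℂ) * z ^ n) * ((v ^ (2 * n) : ℝ) : ℂ) := by
      intro v; push_cast; rw [mul_pow, ← pow_mul]; ring
    simp_rw [h1]
    rw [intervalIntegral.integral_const_mul, intervalIntegral.integral_ofReal, integral_pow,
      hypergeometric_coefficient_eq, smul_eq_mul]
    push_cast
    simp
    ring
  · intro n
    exact Continuous.aestronglyMeasurable (by fun_prop)
  · intro n
    refine Eventually.of_forall fun v hv => ?_
    rw [Set.uIoc_of_le zero_le_one] at hv
    rw [norm_mul, norm_mul]
    refine mul_le_mul_of_nonneg_left ?_ (norm_nonneg _)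
    rw [norm_pow, norm_pow]
    refine pow_le_pow_left₀ (norm_nonneg _) ?_ _
    rw [norm_mul, norm_pow, Complex.norm_real, Real.norm_of_nonneg hv.1.le]
    exact mul_le_of_le_one_right (norm_nonneg _) (pow_le_one₀ hv.1.le hv.2)
  · exact Eventually.of_forall fun v _ => hbound
  · exact intervalIntegrable_const
  · refine Eventually.of_forall fun v hv => ?_
    rw [Set.uIoc_of_le zero_le_one] at hv
    have : ‖z * (v : ℂ) ^ 2‖ < 1 := by
      rw [norm_mul, norm_pow, Complex.norm_real, Real.norm_of_nonneg hv.1.le]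
      exact lt_of_le_of_lt (mul_le_of_le_one_right (norm_nonneg _) (pow_le_one₀ hv.1.le hv.2)) hz
    simpa [one_div] using hasSum_choose_mul_geometric_of_norm_lt_one k this

theorem isHypergeometricBranch_eulerIntegral (k : ℕ) :
    IsHypergeometricBranch (1 / 2) ((k + 1 : ℕ) : ℂ) (3 / 2) (eulerIntegral (k + 1)) := by
  refine ⟨?_, fun z hz => eulerIntegral_eq_hypergeometric k hz⟩
  refine DifferentiableOn.analyticOnNhd (fun z hz =>
    (eulerIntegral_differentiableAt (k + 1) hz).differentiableWithinAt) ?_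
  exact Complex.isOpen_slitPlane.preimage (by fun_prop)

/-- Substitute u = va in Euler's integral. Keeping the factor `a` on the left covers a = 0 as well.
-/
theorem hypergeometricReal_neg_sq (k : ℕ) (a : ℝ) :
    a * hypergeometricReal (1 / 2) ((k + 1 : ℕ) : ℝ) (3 / 2) (-a ^ 2) =
      ∫ u in (0 : ℝ)..a, ((1 + u ^ 2) ^ (k + 1))⁻¹ := by
  have hz : 1 - ((-a ^ 2 : ℝ) : ℂ) ∈ Complex.slitPlane := by
    have : 1 - ((-a ^ 2 : ℝ) : ℂ) = ((1 + a ^ 2 : ℝ) : ℂ) := by push_cast; ring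
    rw [this, Complex.ofReal_mem_slitPlane]
    positivity
  have h := hypergeometricFn_eq_of_isBranch (isHypergeometricBranch_eulerIntegral k) hz
  have h2 : eulerIntegral (k + 1) ((-a ^ 2 : ℝ) : ℂ) =
      ((∫ v in (0 : ℝ)..1, ((1 + (v * a) ^ 2) ^ (k + 1))⁻¹ : ℝ) : ℂ) := by
    rw [eulerIntegral, ← intervalIntegral.integral_ofReal]
    congr 1
    ext v
    push_cast
    ring_nf
  rw [hypergeometricReal]
  push_cast at h ⊢
  push_cast at h2
  rw [h, h2, Complex.ofReal_re]
  have := intervalIntegral.mul_integral_comp_mul_right (a := 0) (b := 1)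
    (f := fun u : ℝ => ((1 + u ^ 2) ^ (k + 1))⁻¹) a
  simpa using this

/-! ### Integrals and tails of (1 + u²)^{-(k+1)} -/

theorem integrable_inv_one_add_sq_pow (k : ℕ) :
    Integrable fun u : ℝ => ((1 + u ^ 2) ^ (k + 1))⁻¹ := by
  refine integrable_inv_one_add_sq.mono' ?_ (Eventually.of_forall fun u => ?_)
  · refine Continuous.aestronglyMeasurable (Continuous.inv₀ (by fun_prop) fun u => ?_)
    positivity
  · rw [Real.norm_of_nonneg (by positivity)]
    refine inv_anti₀ (by positivity) ?_
    exact le_self_pow₀ (by nlinarith [sq_nonneg u]) (by omega)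

/-- The difference of the two integrands is the derivative of u/(1 + u²)^{k+1}, which vanishes at 0
and at infinity. The recursion matches that of the Gamma quotient. -/
theorem integral_Ioi_inv_one_add_sq_pow_succ (k : ℕ) :
    (2 * (k + 1 : ℝ)) * ∫ u in Set.Ioi (0 : ℝ), ((1 + u ^ 2) ^ (k + 2))⁻¹ =
      (2 * k + 1 : ℝ) * ∫ u in Set.Ioi (0 : ℝ), ((1 + u ^ 2) ^ (k + 1))⁻¹ := by
  have i1 := (integrable_inv_one_add_sq_pow k).integrableOn (s := Set.Ioi 0)
  have i2 := (integrable_inv_one_add_sq_pow (k + 1)).integrableOn (s := Set.Ioi 0)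
  have hd : ∀ u ∈ Set.Ici (0 : ℝ), HasDerivAt (fun u : ℝ => u / (1 + u ^ 2) ^ (k + 1))
      ((2 * (k + 1 : ℝ)) * ((1 + u ^ 2) ^ (k + 2))⁻¹ -
        (2 * k + 1 : ℝ) * ((1 + u ^ 2) ^ (k + 1))⁻¹) u := by
    intro u _
    have hne : (1 + u ^ 2) ≠ 0 := by positivity
    have h1 : HasDerivAt (fun u : ℝ => (1 + u ^ 2) ^ (k + 1))
        (((k + 1 : ℕ) : ℝ) * (1 + u ^ 2) ^ k * (2 * u)) u := by
      refine (((hasDerivAt_pow 2 u).const_add 1).pow (k + 1)).congr_deriv ?_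
      simp
    refine ((hasDerivAt_id u).div h1 (pow_ne_zero _ hne)).congr_deriv ?_
    push_cast
    simp only [id]
    field_simp
    ring
  have hlim : Tendsto (fun u : ℝ => u / (1 + u ^ 2) ^ (k + 1)) atTop (𝓝 0) := by
    refine squeeze_zero' ?_ ?_ tendsto_inv_atTop_zero
    · filter_upwards [eventually_ge_atTop 0] with u hu
      positivity
    · filter_upwards [eventually_gt_atTop 0] with u hu
      rw [div_le_iff₀ (by positivity), inv_mul_eq_div, le_div_iff₀ hu]
      calc u * u ≤ 1 + u ^ 2 := by nlinarith
        _ ≤ (1 + u ^ 2) ^ (k + 1) := le_self_pow₀ (by nlinarith [sq_nonneg u]) (by omega)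
  have := integral_Ioi_of_hasDerivAt_of_tendsto' hd ((i2.const_mul _).sub (i1.const_mul _)) hlim
  rw [integral_sub (i2.const_mul _) (i1.const_mul _), integral_const_mul, integral_const_mul] at this
  simp at this
  linarith

theorem integral_Ioi_inv_one_add_sq_pow (k : ℕ) :
    ∫ u in Set.Ioi (0 : ℝ), ((1 + u ^ 2) ^ (k + 1))⁻¹ =
      Real.Gamma (3 / 2) * Real.Gamma (k + 1 / 2) / Real.Gamma (k + 1) := by
  induction k with
  | zero =>
    have h : Real.Gamma (3 / 2) = 1 / 2 * √Real.pi := by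
      rw [show (3 / 2 : ℝ) = 1 / 2 + 1 by norm_num, Real.Gamma_add_one (by norm_num),
        Real.Gamma_one_half_eq]
    simp only [zero_add, pow_one, Nat.cast_zero]
    rw [h, Real.Gamma_one_half_eq, Real.Gamma_one, integral_Ioi_inv_one_add_sq, Real.arctan_zero]
    have := Real.mul_self_sqrt Real.pi_pos.le
    linarith
  | succ k ih =>
    have h := integral_Ioi_inv_one_add_sq_pow_succ k
    rw [ih] at h
    have g1 : Real.Gamma ((k + 1 : ℕ) + 1 / 2) = (k + 1 / 2 : ℝ) * Real.Gamma (k + 1 / 2) := by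
      rw [← Real.Gamma_add_one (by positivity)]; congr 1; push_cast; ring
    have g2 : Real.Gamma ((k + 1 : ℕ) + 1) = (k + 1 : ℝ) * Real.Gamma (k + 1) := by
      rw [← Real.Gamma_add_one (by positivity)]; congr 1; push_cast; ring
    have hG : Real.Gamma (k + 1) ≠ 0 := (Real.Gamma_pos_of_pos (by positivity)).ne'
    rw [g1, g2]
    have hk : (2 * (k + 1 : ℝ)) ≠ 0 := by positivity
    rw [← mul_right_inj' hk, h]
    field_simp

theorem integral_inv_one_add_sq_pow (k : ℕ) :
    ∫ u : ℝ, ((1 + u ^ 2) ^ (k + 1))⁻¹ =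
      2 * ∫ u in Set.Ioi (0 : ℝ), ((1 + u ^ 2) ^ (k + 1))⁻¹ := by
  have := integral_comp_abs (f := fun u : ℝ => ((1 + u ^ 2) ^ (k + 1))⁻¹)
  simpa using this

/-- The bracket of the truncation bound is a tail integral. -/
theorem gamma_sub_hypergeometric_eq_tail (k : ℕ) (a : ℝ) :
    Real.Gamma (3 / 2) * Real.Gamma (k + 1 / 2) / Real.Gamma (k + 1) -
      a * hypergeometricReal (1 / 2) ((k + 1 : ℕ) : ℝ) (3 / 2) (-a ^ 2) =
      ∫ u in Set.Ioi a, ((1 + u ^ 2) ^ (k + 1))⁻¹ := by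
  rw [hypergeometricReal_neg_sq, ← integral_Ioi_inv_one_add_sq_pow, sub_eq_iff_eq_add',
    intervalIntegral.integral_interval_add_Ioi (integrable_inv_one_add_sq_pow k).integrableOn
      (integrable_inv_one_add_sq_pow k).integrableOn]

theorem integral_Ioi_inv_pow (k : ℕ) {a : ℝ} (ha : 0 < a) :
    IntegrableOn (fun u : ℝ => (u ^ (2 * k + 2))⁻¹) (Set.Ioi a) ∧
    ∫ u in Set.Ioi a, (u ^ (2 * k + 2))⁻¹ = 1 / (2 * k + 1) * (a⁻¹) ^ (2 * k + 1) := by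
  have hlt : -(2 * k + 2 : ℝ) < -1 := by
    have : (0 : ℝ) ≤ k := k.cast_nonneg
    linarith
  have he : Set.EqOn (fun u : ℝ => u ^ (-(2 * k + 2 : ℝ))) (fun u : ℝ => (u ^ (2 * k + 2))⁻¹)
      (Set.Ioi a) := by
    intro u hu
    have hu0 : 0 ≤ u := (ha.trans hu).le
    simp only
    rw [Real.rpow_neg hu0, ← Real.rpow_natCast]
    push_cast
    rfl
  refine ⟨(integrableOn_Ioi_rpow_of_lt hlt ha).congr_fun he measurableSet_Ioi, ?_⟩
  rw [← setIntegral_congr_fun measurableSet_Ioi he, integral_Ioi_rpow_of_lt hlt ha]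
  rw [show (-(2 * k + 2 : ℝ) + 1) = -((2 * k + 1 : ℕ) : ℝ) by push_cast; ring,
    Real.rpow_neg ha.le, Real.rpow_natCast]
  push_cast
  rw [inv_pow, neg_div_neg_eq]
  ring

/-- For u > a the integrand lies between (1 + a⁻²)^{-(k+1)} u^{-(2k+2)} and u^{-(2k+2)}; both
constants tend to 1. -/
theorem tail_isEquivalent (k : ℕ) :
    (fun a : ℝ => ∫ u in Set.Ioi a, ((1 + u ^ 2) ^ (k + 1))⁻¹) ~[atTop]
      fun a : ℝ => 1 / (2 * k + 1) * (a⁻¹) ^ (2 * k + 1) := by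
  refine (isEquivalent_iff_tendsto_one ?_).2 ?_
  · filter_upwards [eventually_gt_atTop 0] with a ha
    positivity
  have hlow : Tendsto (fun a : ℝ => ((1 + (a⁻¹) ^ 2) ^ (k + 1))⁻¹) atTop (𝓝 1) := by
    have : Tendsto (fun a : ℝ => ((1 + (a⁻¹) ^ 2) ^ (k + 1))⁻¹) atTop
        (𝓝 ((1 + (0 : ℝ) ^ 2) ^ (k + 1))⁻¹) :=
      (((tendsto_inv_atTop_zero.pow 2).const_add 1).pow (k + 1)).inv₀ (by simp)
    simpa using this
  refine tendsto_of_tendsto_of_tendsto_of_le_of_le' hlow tendsto_const_nhds ?_ ?_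
  · filter_upwards [eventually_gt_atTop 0] with a ha
    obtain ⟨hi, he⟩ := integral_Ioi_inv_pow k ha
    rw [Pi.div_apply, le_div_iff₀ (by positivity), ← he, ← integral_const_mul]
    refine setIntegral_mono_on (hi.const_mul _) (integrable_inv_one_add_sq_pow k).integrableOn
      measurableSet_Ioi fun u hu => ?_
    have hu' : a < u := hu
    have hu0 : 0 < u := ha.trans hu
    rw [← mul_inv, show 2 * k + 2 = 2 * (k + 1) by ring, pow_mul, ← mul_pow]
    refine inv_anti₀ (by positivity) (pow_le_pow_left₀ (by positivity) ?_ _)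
    have : 1 ≤ (a⁻¹) ^ 2 * u ^ 2 := by
      rw [← mul_pow]
      refine one_le_pow₀ ?_
      rw [inv_mul_eq_div, one_le_div ha]; exact hu'.le
    nlinarith
  · filter_upwards [eventually_gt_atTop 0] with a ha
    obtain ⟨hi, he⟩ := integral_Ioi_inv_pow k ha
    rw [Pi.div_apply, div_le_one (by positivity), ← he]
    refine setIntegral_mono_on (integrable_inv_one_add_sq_pow k).integrableOn hi
      measurableSet_Ioi fun u hu => ?_
    have hu0 : 0 < u := ha.trans hu
    refine inv_anti₀ (by positivity) ?_
    rw [show 2 * k + 2 = 2 * (k + 1) by ring, pow_mul]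
    exact pow_le_pow_left₀ (by positivity) (by linarith) _

/-! ### Fourier transform of the Gamma density and Poisson summation -/

section Fourier

open scoped FourierTransform

theorem tendsto_pow_mul_exp_neg_mul_atTop (n : ℕ) {b : ℝ} (hb : 0 < b) :
    Tendsto (fun σ : ℝ => σ ^ n * Real.exp (-(b * σ))) atTop (𝓝 0) := by
  have := (isLittleO_pow_exp_pos_mul_atTop n hb).tendsto_div_nhds_zero
  simpa [Real.exp_neg, div_eq_mul_inv] using this

theorem integrableOn_pow_mul_exp_neg_mul (n : ℕ) {b : ℝ} (hb : 0 < b) :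
    IntegrableOn (fun σ : ℝ => σ ^ n * Real.exp (-(b * σ))) (Set.Ioi 0) := by
  have h := integrableOn_rpow_mul_exp_neg_mul_rpow (s := n) (p := 1) (b := b)
    (by have : (0 : ℝ) ≤ n := n.cast_nonneg
        linarith) one_pos hb
  simpa using h

theorem integrableOn_pow_mul_cexp_neg_mul (n : ℕ) {z : ℂ} (hz : 0 < z.re) :
    IntegrableOn (fun σ : ℝ => (σ : ℂ) ^ n * Complex.exp (-(z * σ))) (Set.Ioi 0) := by
  refine (integrableOn_pow_mul_exp_neg_mul n hz).mono' ?_ ?_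
  · exact Continuous.aestronglyMeasurable (by fun_prop)
  · filter_upwards [ae_restrict_mem measurableSet_Ioi] with σ hσ
    have hσ' : (0 : ℝ) < σ := hσ
    rw [norm_mul, norm_pow, Complex.norm_real, Real.norm_of_nonneg hσ'.le, Complex.norm_exp]
    simp

theorem integral_pow_mul_cexp_neg_mul (n : ℕ) {z : ℂ} (hz : 0 < z.re) :
    ∫ σ in Set.Ioi (0 : ℝ), (σ : ℂ) ^ n * Complex.exp (-(z * σ)) =
      n.factorial * (z ^ (n + 1))⁻¹ := by
  have hz0 : z ≠ 0 := fun h => by simp [h] at hz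
  induction n with
  | zero =>
    have := integral_exp_mul_complex_Ioi (a := -z) (by simpa using hz) 0
    simp only [pow_zero, one_mul, neg_mul] at this ⊢
    rw [this]
    simp
  | succ n ih =>
    have i1 := integrableOn_pow_mul_cexp_neg_mul n hz
    have i2 := integrableOn_pow_mul_cexp_neg_mul (n + 1) hz
    have hd : ∀ σ ∈ Set.Ici (0 : ℝ),
        HasDerivAt (fun σ : ℝ => (σ : ℂ) ^ (n + 1) * Complex.exp (-(z * σ)))
          ((n + 1 : ℂ) * ((σ : ℂ) ^ n * Complex.exp (-(z * σ))) -
            z * ((σ : ℂ) ^ (n + 1) * Complex.exp (-(z * σ)))) σ := by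
      intro σ _
      have h0 : HasDerivAt (fun σ : ℝ => (σ : ℂ)) 1 σ := Complex.ofRealCLM.hasDerivAt
      refine ((h0.pow (n + 1)).mul (h0.const_mul z).neg.cexp).congr_deriv ?_
      simp
      ring
    have hlim : Tendsto (fun σ : ℝ => (σ : ℂ) ^ (n + 1) * Complex.exp (-(z * σ))) atTop (𝓝 0) := by
      rw [tendsto_zero_iff_norm_tendsto_zero]
      refine (tendsto_pow_mul_exp_neg_mul_atTop (n + 1) hz).congr' ?_
      filter_upwards [eventually_ge_atTop 0] with σ hσ
      rw [norm_mul, norm_pow, Complex.norm_real, Real.norm_of_nonneg hσ, Complex.norm_exp]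
      simp
    have := integral_Ioi_of_hasDerivAt_of_tendsto' hd
      ((i1.const_mul _).sub (i2.const_mul _)) hlim
    rw [integral_sub (i1.const_mul _) (i2.const_mul _), integral_const_mul, integral_const_mul,
      ih] at this
    simp at this
    rw [Nat.factorial_succ]
    push_cast
    rw [sub_eq_zero] at this
    rw [← mul_right_inj' hz0, ← this]
    field_simp
    ring

/-- The density `σ₊^{2k+1} e^{-cσ} / (2k+1)!`, whose Laplace transform is
`z ↦ (c + z)^{-2(k+1)}`. -/
noncomputable def gammaKernel (k : ℕ) (c σ : ℝ) : ℝ :=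
  (max σ 0) ^ (2 * k + 1) / (2 * k + 1).factorial * Real.exp (-(c * σ))

theorem gammaKernel_nonneg (k : ℕ) (c σ : ℝ) : 0 ≤ gammaKernel k c σ := by
  unfold gammaKernel; positivity

@[fun_prop]
theorem continuous_gammaKernel (k : ℕ) (c : ℝ) : Continuous (gammaKernel k c) := by
  unfold gammaKernel; fun_prop

/-- The exponent 2k + 1 is positive, so the truncated power is 0 here and not 0⁰ = 1. -/
theorem gammaKernel_of_nonpos (k : ℕ) (c : ℝ) {σ : ℝ} (hσ : σ ≤ 0) : gammaKernel k c σ = 0 := by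
  simp [gammaKernel, max_eq_right hσ]

theorem gammaKernel_of_nonneg (k : ℕ) (c : ℝ) {σ : ℝ} (hσ : 0 ≤ σ) :
    gammaKernel k c σ = ((2 * k + 1).factorial : ℝ)⁻¹ * (σ ^ (2 * k + 1) * Real.exp (-(c * σ))) := by
  simp [gammaKernel, max_eq_left hσ]
  ring

theorem integrable_gammaKernel (k : ℕ) {c : ℝ} (hc : 0 < c) : Integrable (gammaKernel k c) := by
  rw [← integrableOn_iff_integrable_of_support_subset (s := Set.Ioi 0)]
  · exact IntegrableOn.congr_fun ((integrableOn_pow_mul_exp_neg_mul (2 * k + 1) hc).const_mul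
      (((2 * k + 1).factorial : ℝ)⁻¹))
      (fun σ hσ => (gammaKernel_of_nonneg k c (le_of_lt hσ)).symm) measurableSet_Ioi
  · intro σ hσ
    by_contra h
    exact hσ (gammaKernel_of_nonpos k c (not_lt.1 h))

theorem fourier_gammaKernel (k : ℕ) {c : ℝ} (hc : 0 < c) (ξ : ℝ) :
    𝓕 (fun σ : ℝ => (gammaKernel k c σ : ℂ)) ξ =
      (((c : ℂ) + (2 * Real.pi * ξ : ℝ) * Complex.I) ^ (2 * (k + 1)))⁻¹ := by
  rw [Real.fourier_real_eq_integral_exp_smul]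
  rw [← setIntegral_eq_integral_of_forall_compl_eq_zero (s := Set.Ioi 0)]
  · have hz : 0 < ((c : ℂ) + (2 * Real.pi * ξ : ℝ) * Complex.I).re := by simpa using hc
    have hf : ((2 * k + 1).factorial : ℂ) ≠ 0 := by exact_mod_cast Nat.factorial_ne_zero _
    have h := integral_pow_mul_cexp_neg_mul (2 * k + 1) hz
    rw [show 2 * (k + 1) = 2 * k + 1 + 1 by ring, ← mul_right_inj' hf, ← h, ← integral_const_mul]
    refine setIntegral_congr_fun measurableSet_Ioi fun σ hσ => ?_
    rw [gammaKernel_of_nonneg k c (le_of_lt hσ)]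
    push_cast
    rw [smul_eq_mul, add_mul, neg_add, Complex.exp_add]
    rw [show -(2 * Real.pi * ξ * Complex.I * σ : ℂ) = -2 * Real.pi * σ * ξ * Complex.I by ring]
    field_simp
  · intro σ hσ
    rw [gammaKernel_of_nonpos k c (not_lt.1 hσ)]
    simp

theorem norm_inv_pow_add_mul_I (k : ℕ) (c s : ℝ) :
    ‖(((c : ℂ) + s * Complex.I) ^ (2 * (k + 1)))⁻¹‖ = ((c ^ 2 + s ^ 2) ^ (k + 1))⁻¹ := by
  rw [norm_inv, norm_pow, pow_mul, Complex.sq_norm, Complex.normSq_add_mul_I]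

theorem inv_sq_add_sq_pow_eq (k : ℕ) {c : ℝ} (hc : 0 < c) (s : ℝ) :
    ((c ^ 2 + s ^ 2) ^ (k + 1))⁻¹ =
      (c ^ (2 * (k + 1)))⁻¹ * ((1 + (s / c) ^ 2) ^ (k + 1))⁻¹ := by
  rw [← mul_inv, pow_mul, ← mul_pow]
  congr 2
  field_simp

theorem integrable_inv_sq_add_sq_pow (k : ℕ) {c : ℝ} (hc : 0 < c) :
    Integrable fun s : ℝ => ((c ^ 2 + s ^ 2) ^ (k + 1))⁻¹ := by
  simp_rw [inv_sq_add_sq_pow_eq k hc]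
  exact ((integrable_inv_one_add_sq_pow k).comp_div hc.ne').const_mul _

theorem integral_inv_sq_add_sq_pow (k : ℕ) {c : ℝ} (hc : 0 < c) :
    ∫ s : ℝ, ((c ^ 2 + s ^ 2) ^ (k + 1))⁻¹ =
      (c ^ (2 * k + 1))⁻¹ * (2 * ∫ u in Set.Ioi (0 : ℝ), ((1 + u ^ 2) ^ (k + 1))⁻¹) := by
  simp_rw [inv_sq_add_sq_pow_eq k hc]
  rw [integral_const_mul, Measure.integral_comp_div (fun u : ℝ => ((1 + u ^ 2) ^ (k + 1))⁻¹),
    integral_inv_one_add_sq_pow, abs_of_pos hc, smul_eq_mul]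
  field_simp
  ring

theorem integral_Ioi_inv_sq_add_sq_pow (k : ℕ) {c : ℝ} (hc : 0 < c) (b : ℝ) :
    ∫ s in Set.Ioi b, ((c ^ 2 + s ^ 2) ^ (k + 1))⁻¹ =
      (c ^ (2 * k + 1))⁻¹ * ∫ u in Set.Ioi (b / c), ((1 + u ^ 2) ^ (k + 1))⁻¹ := by
  simp_rw [inv_sq_add_sq_pow_eq k hc]
  have := integral_comp_mul_right_Ioi (fun u : ℝ => ((1 + u ^ 2) ^ (k + 1))⁻¹) b
    (inv_pos.2 hc)
  simp only [← div_eq_mul_inv, inv_inv] at this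
  rw [integral_const_mul, this, smul_eq_mul]
  field_simp
  ring

theorem integrable_inv_pow_add_mul_I (k : ℕ) {c : ℝ} (hc : 0 < c) :
    Integrable fun s : ℝ => (((c : ℂ) + s * Complex.I) ^ (2 * (k + 1)))⁻¹ := by
  refine (integrable_inv_sq_add_sq_pow k hc).mono' ?_
    (Eventually.of_forall fun s => (norm_inv_pow_add_mul_I k c s).le)
  refine Continuous.aestronglyMeasurable (Continuous.inv₀ (by fun_prop) fun s => pow_ne_zero _ ?_)
  intro h
  have := congrArg Complex.re h
  simp at this
  exact hc.ne' this

/-- Fourier inversion, valid pointwise because the kernel is continuous and its transform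
integrable; the factor 2π comes from rescaling the frequency. -/
theorem integral_inv_pow_mul_cexp (k : ℕ) {c : ℝ} (hc : 0 < c) (σ : ℝ) :
    ∫ s : ℝ, (((c : ℂ) + s * Complex.I) ^ (2 * (k + 1)))⁻¹ * Complex.exp (s * σ * Complex.I) =
      2 * Real.pi * gammaKernel k c σ := by
  have hF : Integrable (𝓕 fun σ : ℝ => (gammaKernel k c σ : ℂ)) := by
    rw [show (𝓕 fun σ : ℝ => (gammaKernel k c σ : ℂ)) = _ from funext (fourier_gammaKernel k hc)]
    exact (integrable_inv_pow_add_mul_I k hc).comp_mul_left' (by positivity)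
  have h := (integrable_gammaKernel k hc).ofReal.fourierInv_fourier_eq hF
    (v := σ) (by fun_prop)
  rw [Real.fourierInv_eq'] at h
  simp_rw [fourier_gammaKernel k hc] at h
  have h2 := Measure.integral_comp_mul_left (fun s : ℝ =>
    (((c : ℂ) + s * Complex.I) ^ (2 * (k + 1)))⁻¹ * Complex.exp (s * σ * Complex.I)) (2 * Real.pi)
  have h3 : ∫ s : ℝ, (((c : ℂ) + (2 * Real.pi * s : ℝ) * Complex.I) ^ (2 * (k + 1)))⁻¹ *
      Complex.exp ((2 * Real.pi * s : ℝ) * σ * Complex.I) = gammaKernel k c σ := by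
    rw [← h]
    congr 1
    ext s
    rw [smul_eq_mul, mul_comm]
    congr 2
    simp
    ring
  rw [h3, abs_of_pos (by positivity), Complex.real_smul] at h2
  rw [h2]
  push_cast
  have : (2 * Real.pi : ℂ) ≠ 0 := by simp [Real.pi_ne_zero]
  rw [mul_inv_cancel_left₀ this]

/-- Triangle inequality in the inversion formula. Bounding the kernel this way, and not by its exact
maximum, is what puts the Gamma quotient into the discretization bound. -/
theorem gammaKernel_le (k : ℕ) {c : ℝ} (hc : 0 < c) (σ : ℝ) :
    gammaKernel k c σ ≤ Real.pi⁻¹ * (c ^ (2 * k + 1))⁻¹ *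
      ∫ u in Set.Ioi (0 : ℝ), ((1 + u ^ 2) ^ (k + 1))⁻¹ := by
  have h := congrArg norm (integral_inv_pow_mul_cexp k hc σ)
  have h2 : ‖(2 * Real.pi * gammaKernel k c σ : ℂ)‖ = 2 * Real.pi * gammaKernel k c σ := by
    rw [norm_mul, norm_mul, Complex.norm_real, Complex.norm_real,
      Real.norm_of_nonneg (gammaKernel_nonneg _ _ _), Real.norm_of_nonneg Real.pi_pos.le]
    simp
  have h3 := norm_integral_le_integral_norm (μ := volume) (fun s : ℝ =>
    (((c : ℂ) + s * Complex.I) ^ (2 * (k + 1)))⁻¹ * Complex.exp (s * σ * Complex.I))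
  have h4 : ∀ s : ℝ, ‖(((c : ℂ) + s * Complex.I) ^ (2 * (k + 1)))⁻¹ *
      Complex.exp (s * σ * Complex.I)‖ = ((c ^ 2 + s ^ 2) ^ (k + 1))⁻¹ := by
    intro s
    rw [norm_mul, norm_inv_pow_add_mul_I, ← Complex.ofReal_mul, Complex.norm_exp_ofReal_mul_I,
      mul_one]
  simp_rw [h4] at h3
  rw [h, h2, integral_inv_sq_add_sq_pow k hc] at h3
  have hp := Real.pi_pos
  rw [mul_assoc, ← div_eq_inv_mul, le_div_iff₀ hp]
  linarith

/-- Multiplication by σ² raises `k` by one up to the factor (2k+3)(2k+2), and the kernel of index k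
+ 1 is bounded. -/
theorem gammaKernel_isBigO (k : ℕ) {c : ℝ} (hc : 0 < c) :
    (fun σ : ℝ => (gammaKernel k c σ : ℂ)) =O[cocompact ℝ] fun σ => |σ| ^ (-2 : ℝ) := by
  refine IsBigO.of_bound ((2 * k + 3) * (2 * k + 2) * (Real.pi⁻¹ * (c ^ (2 * (k + 1) + 1))⁻¹ *
      ∫ u in Set.Ioi (0 : ℝ), ((1 + u ^ 2) ^ (k + 1 + 1))⁻¹)) ?_
  have hne : ∀ᶠ σ : ℝ in cocompact ℝ, σ ≠ 0 :=
    (isCompact_singleton (x := (0 : ℝ))).compl_mem_cocompact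
  filter_upwards [hne] with σ hσ
  rw [Complex.norm_real, Real.norm_of_nonneg (gammaKernel_nonneg _ _ _),
    Real.rpow_neg (abs_nonneg _), Real.rpow_two, sq_abs, Real.norm_of_nonneg (by positivity),
    ← div_eq_mul_inv, le_div_iff₀ (by positivity)]
  have h := gammaKernel_le (k + 1) hc σ
  have e : gammaKernel k c σ * σ ^ 2 = (2 * k + 3) * (2 * k + 2) * gammaKernel (k + 1) c σ := by
    rcases le_or_gt σ 0 with h0 | h0
    · simp [gammaKernel_of_nonpos _ _ h0]
    · rw [gammaKernel_of_nonneg _ _ h0.le, gammaKernel_of_nonneg _ _ h0.le]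
      have hf : ((2 * (k + 1) + 1).factorial : ℝ) =
          (2 * k + 3) * (2 * k + 2) * (2 * k + 1).factorial := by
        rw [show 2 * (k + 1) + 1 = 2 * k + 1 + 1 + 1 by ring, Nat.factorial_succ,
          Nat.factorial_succ]
        push_cast
        ring
      have hf0 : ((2 * k + 1).factorial : ℝ) ≠ 0 := by positivity
      rw [hf]
      generalize ((2 * k + 1).factorial : ℝ) = f at hf0
      field_simp
      ring
  rw [e]
  gcongr

theorem fourier_gammaKernel_isBigO (k : ℕ) {c : ℝ} (hc : 0 < c) :
    (𝓕 fun σ : ℝ => (gammaKernel k c σ : ℂ)) =O[cocompact ℝ] fun σ => |σ| ^ (-2 : ℝ) := by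
  refine IsBigO.of_bound ((c ^ (2 * k))⁻¹) ?_
  have hne : ∀ᶠ σ : ℝ in cocompact ℝ, σ ≠ 0 :=
    (isCompact_singleton (x := (0 : ℝ))).compl_mem_cocompact
  filter_upwards [hne] with σ hσ
  rw [fourier_gammaKernel k hc, norm_inv_pow_add_mul_I,
    Real.rpow_neg (abs_nonneg _), Real.rpow_two, sq_abs, Real.norm_of_nonneg (by positivity),
    ← mul_inv]
  refine inv_anti₀ (by positivity) ?_
  have hpi : 1 ≤ (2 * Real.pi) ^ 2 := one_le_pow₀ (by linarith [Real.pi_gt_three])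
  rw [pow_succ (c ^ 2 + _) k, pow_mul c 2 k]
  refine mul_le_mul (pow_le_pow_left₀ (by positivity)
    (le_add_of_nonneg_right (by positivity)) _) ?_ (by positivity) (by positivity)
  rw [mul_pow]
  nlinarith [sq_nonneg c, sq_nonneg σ]

theorem gammaKernel_mul_left (k : ℕ) (c : ℝ) {a : ℝ} (ha : 0 < a) (σ : ℝ) :
    gammaKernel k c (a * σ) = a ^ (2 * k + 1) * gammaKernel k (a * c) σ := by
  have : max (a * σ) 0 = a * max σ 0 := by rw [mul_max_of_nonneg _ _ ha.le, mul_zero]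
  rw [gammaKernel, gammaKernel, this, mul_pow, show c * (a * σ) = a * c * σ by ring]
  ring

/-- Poisson summation with period `a`, reduced to period 1 by scaling: the rescaled kernel has decay
rate `a * c`. -/
theorem tsum_gammaKernel (k : ℕ) {c a : ℝ} (hc : 0 < c) (ha : 0 < a) (σ : ℝ) :
    ((∑' n : ℤ, gammaKernel k c (σ + a * n) : ℝ) : ℂ) =
      (a : ℂ)⁻¹ * ∑' j : ℤ, (((c : ℂ) + (2 * Real.pi / a * j : ℝ) * Complex.I) ^ (2 * (k + 1)))⁻¹ *
        Complex.exp ((2 * Real.pi / a * j : ℝ) * σ * Complex.I) := by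
  have hac : 0 < a * c := mul_pos ha hc
  have h := Real.tsum_eq_tsum_fourier_of_rpow_decay
    (f := fun σ : ℝ => (gammaKernel k (a * c) σ : ℂ)) (by fun_prop) one_lt_two
    (gammaKernel_isBigO k hac) (fourier_gammaKernel_isBigO k hac) (σ / a)
  have e : ∀ n : ℤ, gammaKernel k c (σ + a * n) =
      a ^ (2 * k + 1) * gammaKernel k (a * c) (σ / a + n) := by
    intro n
    rw [← gammaKernel_mul_left k c ha]
    congr 1
    field_simp
  simp_rw [e]
  rw [tsum_mul_left, Complex.ofReal_mul, Complex.ofReal_tsum, h, ← tsum_mul_left, ← tsum_mul_left]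
  refine tsum_congr fun j => ?_
  rw [fourier_gammaKernel k hac, fourier_coe_apply]
  have ha' : (a : ℂ) ≠ 0 := by exact_mod_cast ha.ne'
  rw [← mul_assoc, ← mul_assoc]
  congr 1
  · have : ((a * c : ℝ) : ℂ) + (2 * Real.pi * j : ℝ) * Complex.I =
        a * (c + (2 * Real.pi / a * j : ℝ) * Complex.I) := by
      push_cast; field_simp
    rw [this, mul_pow, mul_inv, show 2 * (k + 1) = 2 * k + 1 + 1 by ring]
    push_cast
    field_simp
    ring
  · congr 1
    push_cast
    field_simp

end Fourier

/-- The scalar factor `r(z) e^{zv}` of the contour integrand at `z = δ + is`. -/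
noncomputable def contourKernel (k : ℕ) (δ v s : ℝ) : ℂ :=
  regularizer δ (2 * (k + 1)) (contourPoint δ s) * Complex.exp (contourPoint δ s * v)

/-! ### The scalar trapezoidal rule -/

theorem contourKernel_eq (k : ℕ) (δ v s : ℝ) :
    contourKernel k δ v s = (Real.exp (δ * v) : ℂ) *
      ((((δ : ℂ) + (-s : ℝ) * Complex.I) ^ (2 * (k + 1)))⁻¹ *
        Complex.exp ((-s : ℝ) * (-v : ℝ) * Complex.I)) := by
  rw [contourKernel, regularizer, contourPoint]
  rw [show 2 * (δ : ℂ) - (δ + Complex.I * s) = (δ : ℂ) + (-s : ℝ) * Complex.I by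
    push_cast; ring]
  rw [mul_left_comm]
  congr 1
  rw [Complex.ofReal_exp, ← Complex.exp_add]
  congr 1
  push_cast
  ring

theorem norm_contourKernel (k : ℕ) (δ v s : ℝ) :
    ‖contourKernel k δ v s‖ = Real.exp (δ * v) * ((δ ^ 2 + s ^ 2) ^ (k + 1))⁻¹ := by
  rw [contourKernel_eq, norm_mul, norm_mul, norm_inv_pow_add_mul_I, ← Complex.ofReal_mul,
    Complex.norm_exp_ofReal_mul_I, Complex.norm_real, Real.norm_of_nonneg (Real.exp_pos _).le]
  ring

theorem contourKernel_add (k : ℕ) (δ v w s : ℝ) :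
    contourKernel k δ (v + w) s = contourKernel k δ v s * Complex.exp (contourPoint δ s * w) := by
  rw [contourKernel, contourKernel, mul_assoc, ← Complex.exp_add]
  congr 2
  push_cast
  ring

theorem integral_contourKernel (k : ℕ) {δ : ℝ} (hδ : 0 < δ) (v : ℝ) :
    ∫ s : ℝ, contourKernel k δ v s =
      2 * Real.pi * ((Real.exp (δ * v) * gammaKernel k δ (-v) : ℝ) : ℂ) := by
  simp_rw [contourKernel_eq]
  have h := integral_neg_eq_self (μ := volume) (fun s : ℝ =>
    (((δ : ℂ) + s * Complex.I) ^ (2 * (k + 1)))⁻¹ * Complex.exp (s * (-v : ℝ) * Complex.I))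
  rw [integral_inv_pow_mul_cexp k hδ] at h
  rw [integral_const_mul, h]
  push_cast
  ring

/-- Sampling with spacing `h` periodizes the kernel with period 2π/h; the term n = 0 is the exact
integral. The nodes are reflected, j ↦ -j, because the contour kernel involves -s. -/
theorem tsum_contourKernel (k : ℕ) {δ h : ℝ} (hδ : 0 < δ) (hh : 0 < h) (v : ℝ) :
    (h / (2 * Real.pi) : ℂ) * ∑' j : ℤ, contourKernel k δ v (h * j) =
      ((Real.exp (δ * v) * ∑' n : ℤ, gammaKernel k δ (-v + 2 * Real.pi / h * n) : ℝ) : ℂ) := by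
  have hpi := Real.pi_pos
  simp_rw [contourKernel_eq]
  rw [Complex.ofReal_mul, tsum_gammaKernel k hδ (by positivity) (-v), tsum_mul_left,
    ← (Equiv.neg ℤ).tsum_eq (fun j : ℤ => (((δ : ℂ) +
      (2 * Real.pi / (2 * Real.pi / h) * j : ℝ) * Complex.I) ^ (2 * (k + 1)))⁻¹ *
        Complex.exp ((2 * Real.pi / (2 * Real.pi / h) * j : ℝ) * (-v : ℝ) * Complex.I)),
    mul_left_comm]
  congr 2
  · push_cast
    rw [inv_div]
  · refine tsum_congr fun j => ?_
    have : 2 * Real.pi / (2 * Real.pi / h) * ((Equiv.neg ℤ j : ℤ) : ℝ) = -(h * j) := by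
      simp only [Equiv.neg_apply]
      push_cast
      field_simp
    rw [this]

/-- A uniform bound for `gammaKernel k (δ/2)`. -/
noncomputable def gammaKernelBound (k : ℕ) (δ : ℝ) : ℝ :=
  Real.pi⁻¹ * ((δ / 2) ^ (2 * k + 1))⁻¹ * ∫ u in Set.Ioi (0 : ℝ), ((1 + u ^ 2) ^ (k + 1))⁻¹

theorem gammaKernelBound_nonneg (k : ℕ) {δ : ℝ} (hδ : 0 < δ) : 0 ≤ gammaKernelBound k δ :=
  (gammaKernel_nonneg k (δ / 2) 0).trans (gammaKernel_le k (half_pos hδ) 0)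

/-- Half of the decay rate goes into the uniform bound, whence its argument δ/2; the other half is
kept to sum the translates. -/
theorem gammaKernel_le_exp (k : ℕ) {δ : ℝ} (hδ : 0 < δ) (σ : ℝ) :
    gammaKernel k δ σ ≤ gammaKernelBound k δ * Real.exp (-(δ / 2 * σ)) := by
  have h := gammaKernel_le k (half_pos hδ) σ
  have e : gammaKernel k δ σ = gammaKernel k (δ / 2) σ * Real.exp (-(δ / 2 * σ)) := by
    rw [gammaKernel, gammaKernel, mul_assoc, ← Real.exp_add]
    congr 2
    ring
  rw [e]
  exact mul_le_mul_of_nonneg_right h (Real.exp_pos _).le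

theorem exp_mul_gammaKernel_le_of_pos (k : ℕ) {δ : ℝ} (hδ : 0 < δ) (v b : ℝ) :
    Real.exp (δ * v) * gammaKernel k δ (-v + b) ≤
      gammaKernelBound k δ * Real.exp (3 * δ * v / 2) * Real.exp (-(δ / 2 * b)) := by
  refine (mul_le_mul_of_nonneg_left (gammaKernel_le_exp k hδ _) (Real.exp_pos _).le).trans_eq ?_
  rw [mul_left_comm, mul_assoc, ← Real.exp_add, ← Real.exp_add]
  congr 2
  ring

/-- The exponential bound alone would grow with `b`. The kernel vanishes unless v + b < 0, and then
lowering the exponent 3δv/2 + δb/2 by δ(v + b) only increases the bound, which turns growth in `b`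
into decay. -/
theorem exp_mul_gammaKernel_le_of_neg (k : ℕ) {δ : ℝ} (hδ : 0 < δ) (v b : ℝ) :
    Real.exp (δ * v) * gammaKernel k δ (-v - b) ≤
      gammaKernelBound k δ * Real.exp (δ * v / 2) * Real.exp (-(δ / 2 * b)) := by
  have hG := gammaKernelBound_nonneg k hδ
  rcases le_or_gt (-v - b) 0 with h | h
  · rw [gammaKernel_of_nonpos k δ h, mul_zero]
    positivity
  · refine (mul_le_mul_of_nonneg_left (gammaKernel_le_exp k hδ _) (Real.exp_pos _).le).trans ?_
    rw [mul_left_comm, mul_assoc, ← Real.exp_add, ← Real.exp_add]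
    refine mul_le_mul_of_nonneg_left (Real.exp_le_exp.2 ?_) hG
    nlinarith

theorem hasSum_exp_neg_succ {b : ℝ} (hb : 0 < b) :
    HasSum (fun n : ℕ => Real.exp (-(b * (n + 1)))) (Real.exp b - 1)⁻¹ := by
  have h1 : Real.exp (-b) < 1 := Real.exp_lt_one_iff.2 (by linarith)
  have h := (hasSum_geometric_of_lt_one (Real.exp_pos (-b)).le h1).mul_left (Real.exp (-b))
  have hE : 1 < Real.exp b := Real.one_lt_exp_iff.2 hb
  have e1 : (fun n : ℕ => Real.exp (-(b * (n + 1)))) =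
      fun n : ℕ => Real.exp (-b) * Real.exp (-b) ^ n := by
    ext n
    rw [← Real.exp_nat_mul, ← Real.exp_add]
    congr 1
    ring
  have e2 : (Real.exp b - 1)⁻¹ = Real.exp (-b) * (1 - Real.exp (-b))⁻¹ := by
    rw [Real.exp_neg] at h1 ⊢
    have := Real.exp_pos b
    have h2 : Real.exp b - 1 ≠ 0 := by linarith
    have h3 : 1 - (Real.exp b)⁻¹ ≠ 0 := by linarith
    field_simp
  rw [e1, e2]
  exact h

/-- The scalar trapezoidal error, by Poisson summation. -/
theorem norm_integral_sub_tsum_contourKernel_le (k : ℕ) {δ h : ℝ} (hδ : 0 < δ) (hh : 0 < h)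
    (v : ℝ) :
    ‖(1 / (2 * Real.pi) : ℂ) * (∫ s : ℝ, contourKernel k δ v s) -
      (h / (2 * Real.pi) : ℂ) * ∑' j : ℤ, contourKernel k δ v (h * j)‖ ≤
      gammaKernelBound k δ * (Real.exp (δ * Real.pi / h) - 1)⁻¹ *
        (Real.exp (3 * δ * v / 2) + Real.exp (δ * v / 2)) := by
  have hpi := Real.pi_pos
  have hpi' : (2 * Real.pi : ℂ) ≠ 0 := by simp [Real.pi_ne_zero]
  set a : ℝ := 2 * Real.pi / h with ha
  have ha0 : 0 < a := by positivity
  have hb : 0 < δ * Real.pi / h := by positivity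
  -- Rate δ/2 over the period 2π/h gives the ratio e^{-δπ/h} of the geometric series.
  have hab : ∀ n : ℝ, δ / 2 * (a * n) = δ * Real.pi / h * n := by
    intro n; rw [ha]; field_simp
  have hg := hasSum_exp_neg_succ hb
  set f : ℤ → ℝ := fun n => Real.exp (δ * v) * gammaKernel k δ (-v + a * n) with hf
  have hf0 : ∀ n, 0 ≤ f n := fun n => mul_nonneg (Real.exp_pos _).le (gammaKernel_nonneg _ _ _)
  have hp : ∀ n : ℕ, f (n + 1) ≤ gammaKernelBound k δ * Real.exp (3 * δ * v / 2) *
      Real.exp (-(δ * Real.pi / h * (n + 1))) := by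
    intro n
    have := exp_mul_gammaKernel_le_of_pos k hδ v (a * (n + 1))
    rw [hab] at this
    simpa [hf] using this
  have hn : ∀ n : ℕ, f (-(n + 1)) ≤ gammaKernelBound k δ * Real.exp (δ * v / 2) *
      Real.exp (-(δ * Real.pi / h * (n + 1))) := by
    intro n
    have := exp_mul_gammaKernel_le_of_neg k hδ v (a * (n + 1))
    rw [hab] at this
    convert this using 3
    push_cast
    ring
  have sp : Summable fun n : ℕ => f (n + 1) :=
    Summable.of_nonneg_of_le (fun _ => hf0 _) hp (hg.summable.mul_left _)
  have sn : Summable fun n : ℕ => f (-(n + 1)) :=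
    Summable.of_nonneg_of_le (fun _ => hf0 _) hn (hg.summable.mul_left _)
  have tp := hasSum_le hp sp.hasSum (hg.mul_left _)
  have tn := hasSum_le hn sn.hasSum (hg.mul_left _)
  have hsum := tsum_of_add_one_of_neg_add_one sp sn
  have p0 : 0 ≤ ∑' n : ℕ, f (n + 1) := tsum_nonneg fun _ => hf0 _
  have n0 : 0 ≤ ∑' n : ℕ, f (-(n + 1)) := tsum_nonneg fun _ => hf0 _
  rw [integral_contourKernel k hδ, tsum_contourKernel k hδ hh, one_div,
    inv_mul_cancel_left₀ hpi', ← Complex.ofReal_sub, Complex.norm_real]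
  have e0 : Real.exp (δ * v) * gammaKernel k δ (-v) = f 0 := by simp [hf]
  have e1 : Real.exp (δ * v) * ∑' n : ℤ, gammaKernel k δ (-v + 2 * Real.pi / h * n) =
      ∑' n : ℤ, f n := tsum_mul_left.symm
  -- The term `f 0` cancels; the error is minus the sum of two nonnegative tails.
  rw [e0, e1, hsum, Real.norm_eq_abs, abs_le]
  constructor <;> nlinarith

/-! ### The resolvent and its powers as Laplace transforms of orbits -/

section Semigroup

variable {X : Type*} [NormedAddCommGroup X] [NormedSpace ℂ X]
  {A : X →ₗ.[ℂ] X} {K : ℝ → X →L[ℂ] X} {M : ℝ}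

theorem HasGrowthBound.norm_le (hM : HasGrowthBound K M 0) {t : ℝ} (ht : 0 ≤ t) : ‖K t‖ ≤ M := by
  simpa using hM t ht

theorem HasGrowthBound.norm_apply_le (hM : HasGrowthBound K M 0) {t : ℝ} (ht : 0 ≤ t) (y : X) :
    ‖K t y‖ ≤ M * ‖y‖ :=
  (K t).le_of_opNorm_le (hM.norm_le ht) y

/-- `K` is arbitrary at negative times. Freezing the orbit there gives a function continuous on the
whole line, to which the fundamental theorem of calculus applies at 0. -/
theorem IsC0Semigroup.continuous_orbit_max (hK : IsC0Semigroup K) (y : X) :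
    Continuous fun τ : ℝ => K (max τ 0) y :=
  (hK.continuous_orbit y).comp_continuous (by fun_prop) fun τ => Set.mem_Ici.2 (le_max_right τ 0)

theorem IsC0Semigroup.map_add_apply (hK : IsC0Semigroup K) {s t : ℝ} (hs : 0 ≤ s) (ht : 0 ≤ t)
    (y : X) : K (s + t) y = K s (K t y) := by
  rw [hK.map_add s t hs ht]; rfl

theorem IsC0Semigroup.aestronglyMeasurable_orbit (hK : IsC0Semigroup K) (y : X) :
    AEStronglyMeasurable (fun τ => K τ y) (volume.restrict (Set.Ioi 0)) :=
  ((hK.continuous_orbit y).mono Set.Ioi_subset_Ici_self).aestronglyMeasurable measurableSet_Ioi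

theorem IsC0Semigroup.integrableOn_smul_orbit (hK : IsC0Semigroup K) (hM : HasGrowthBound K M 0)
    {g : ℝ → ℂ} (hg : IntegrableOn g (Set.Ioi 0)) (y : X) :
    IntegrableOn (fun τ => g τ • K τ y) (Set.Ioi 0) := by
  refine (hg.norm.mul_const (M * ‖y‖)).mono' (hg.1.smul (hK.aestronglyMeasurable_orbit y)) ?_
  filter_upwards [ae_restrict_mem measurableSet_Ioi] with τ hτ
  rw [norm_smul]
  exact mul_le_mul_of_nonneg_left (hM.norm_apply_le (le_of_lt hτ) y) (norm_nonneg _)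

omit [NormedSpace ℂ X] in
theorem integral_Ioi_comp_add_right [NormedSpace ℝ X] (f : ℝ → X) (s : ℝ) :
    ∫ τ in Set.Ioi (0 : ℝ), f (τ + s) = ∫ τ in Set.Ioi s, f τ := by
  have := (measurePreserving_add_right volume s).setIntegral_preimage_emb
    (measurableEmbedding_addRight s) f (Set.Ioi s)
  simpa using this

theorem integrableOn_cexp_neg_mul {z : ℂ} (hz : 0 < z.re) :
    IntegrableOn (fun τ : ℝ => Complex.exp (-(z * τ))) (Set.Ioi 0) := by
  simpa using integrableOn_pow_mul_cexp_neg_mul 0 hz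

theorem opApply_of_mem_graph {x y : X} (h : (x, y) ∈ A.graph) :
    x ∈ A.domain ∧ opApply A x = y := by
  obtain ⟨u, hu, hy⟩ := A.mem_graph_iff.1 h
  simp only at hu hy
  subst hu
  exact ⟨u.2, by rw [opApply, dif_pos u.2]; exact hy⟩

theorem mem_graph_opApply {x : X} (hx : x ∈ A.domain) : (x, opApply A x) ∈ A.graph := by
  rw [opApply, dif_pos hx]
  exact A.mem_graph ⟨x, hx⟩

theorem IsGeneratorOf.tendsto (hA : IsGeneratorOf A K) {u : X} (hu : u ∈ A.domain) :
    Tendsto (fun t : ℝ => ((t : ℂ)⁻¹) • (K t u - u)) (𝓝[>] 0) (𝓝 (opApply A u)) :=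
  (hA _ _).1 (mem_graph_opApply hu)

/-- The Laplace transform `∫₀^∞ e^{-zτ} K(τ) y dτ` of an orbit. -/
noncomputable def semigroupLaplace (K : ℝ → X →L[ℂ] X) (z : ℂ) (y : X) : X :=
  ∫ τ in Set.Ioi (0 : ℝ), Complex.exp (-(z * τ)) • K τ y

section Laplace

variable (hK : IsC0Semigroup K) (hM : HasGrowthBound K M 0) {z : ℂ} (hz : 0 < z.re)

include hK hM hz

theorem semigroupLaplace_integrable (y : X) :
    IntegrableOn (fun τ : ℝ => Complex.exp (-(z * τ)) • K τ y) (Set.Ioi 0) :=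
  hK.integrableOn_smul_orbit hM (integrableOn_cexp_neg_mul hz) y

theorem semigroupLaplace_sub (u v : X) :
    semigroupLaplace K z (u - v) = semigroupLaplace K z u - semigroupLaplace K z v := by
  rw [semigroupLaplace, semigroupLaplace, semigroupLaplace,
    ← integral_sub (semigroupLaplace_integrable hK hM hz u) (semigroupLaplace_integrable hK hM hz v)]
  simp [smul_sub]

omit hK hM hz in
theorem semigroupLaplace_smul (c : ℂ) (u : X) :
    semigroupLaplace K z (c • u) = c • semigroupLaplace K z u := by
  rw [semigroupLaplace, semigroupLaplace, ← integral_smul]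
  simp [smul_comm c]

omit hK in
theorem norm_semigroupLaplace_le (y : X) : ‖semigroupLaplace K z y‖ ≤ M / z.re * ‖y‖ := by
  have h1 : ∫ τ in Set.Ioi (0 : ℝ), Real.exp (-z.re * τ) = 1 / z.re := by
    rw [integral_exp_mul_Ioi (by linarith)]; simp
  have h2 := integrableOn_exp_mul_Ioi (a := -z.re) (by linarith) 0
  calc ‖semigroupLaplace K z y‖
      ≤ ∫ τ in Set.Ioi (0 : ℝ), Real.exp (-z.re * τ) * (M * ‖y‖) := by
        refine norm_integral_le_of_norm_le (h2.mul_const _) ?_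
        filter_upwards [ae_restrict_mem measurableSet_Ioi] with τ hτ
        rw [norm_smul, Complex.norm_exp]
        have : (-(z * (τ : ℂ))).re = -z.re * τ := by simp
        rw [this]
        exact mul_le_mul_of_nonneg_left (hM.norm_apply_le (le_of_lt hτ) y) (Real.exp_pos _).le
    _ = M / z.re * ‖y‖ := by
        rw [integral_mul_const, h1]; ring

theorem continuous_semigroupLaplace : Continuous (semigroupLaplace K z) := by
  let L : X →ₗ[ℂ] X :=
    { toFun := semigroupLaplace K z
      map_add' := fun u v => by
        have := semigroupLaplace_sub hK hM hz (u + v) v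
        rw [add_sub_cancel_right] at this
        rw [this, sub_add_cancel]
      map_smul' := fun c u => semigroupLaplace_smul c u }
  exact (L.mkContinuous (M / z.re) (norm_semigroupLaplace_le hM hz)).continuous

variable [CompleteSpace X]

theorem semigroup_apply_semigroupLaplace {s : ℝ} (hs : 0 ≤ s) (y : X) :
    K s (semigroupLaplace K z y) = semigroupLaplace K z (K s y) := by
  rw [semigroupLaplace, semigroupLaplace,
    ← (K s).integral_comp_comm (semigroupLaplace_integrable hK hM hz y)]
  refine setIntegral_congr_fun measurableSet_Ioi fun τ hτ => ?_
  simp only [map_smul]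
  rw [← hK.map_add_apply hs (le_of_lt hτ), add_comm, hK.map_add_apply (le_of_lt hτ) hs]

/-- Shift the integration variable by `s`. The right-hand side is visibly differentiable at s = 0,
with derivative zR - y for R the Laplace transform; this identifies AR. -/
theorem semigroup_apply_semigroupLaplace_eq {s : ℝ} (hs : 0 ≤ s) (y : X) :
    K s (semigroupLaplace K z y) = Complex.exp (z * s) • (semigroupLaplace K z y -
      ∫ τ in (0 : ℝ)..s, Complex.exp (-(z * τ)) • K (max τ 0) y) := by
  have hi := semigroupLaplace_integrable hK hM hz y
  have e1 : ∫ τ in (0 : ℝ)..s, Complex.exp (-(z * τ)) • K (max τ 0) y =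
      ∫ τ in (0 : ℝ)..s, Complex.exp (-(z * τ)) • K τ y := by
    refine intervalIntegral.integral_congr fun τ hτ => ?_
    rw [Set.uIcc_of_le hs] at hτ
    simp only [max_eq_left hτ.1]
  have e2 := intervalIntegral.integral_interval_add_Ioi hi
    (hi.mono_set (Set.Ioi_subset_Ioi hs))
  rw [e1, semigroupLaplace, ← eq_sub_iff_add_eq'.2 e2, ← integral_smul,
    ← (K s).integral_comp_comm hi]
  rw [← integral_Ioi_comp_add_right
    (fun τ : ℝ => Complex.exp (z * s) • Complex.exp (-(z * τ)) • K τ y) s]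
  refine setIntegral_congr_fun measurableSet_Ioi fun τ hτ => ?_
  simp only [map_smul]
  rw [smul_smul, ← Complex.exp_add, ← hK.map_add_apply hs (le_of_lt hτ), add_comm τ s]
  congr 2
  push_cast
  ring

theorem semigroupLaplace_mem_graph (hA : IsGeneratorOf A K) (y : X) :
    (semigroupLaplace K z y, z • semigroupLaplace K z y - y) ∈ A.graph := by
  rw [hA]
  set R := semigroupLaplace K z y
  have hφ : Continuous fun τ : ℝ => Complex.exp (-(z * τ)) • K (max τ 0) y :=
    Continuous.smul (by fun_prop) (hK.continuous_orbit_max y)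
  have hd1 : HasDerivAt (fun s : ℝ => ∫ τ in (0 : ℝ)..s, Complex.exp (-(z * τ)) • K (max τ 0) y)
      y 0 := by
    have := hφ.integral_hasStrictDerivAt 0 0
    simpa [hK.map_zero] using this.hasDerivAt
  have hd2 : HasDerivAt (fun s : ℝ => Complex.exp (z * s)) z 0 := by
    have h0 : HasDerivAt (fun σ : ℝ => (σ : ℂ)) 1 0 := Complex.ofRealCLM.hasDerivAt
    simpa using (h0.const_mul z).cexp
  have hd : HasDerivAt (fun s : ℝ => Complex.exp (z * s) • (R -
      ∫ τ in (0 : ℝ)..s, Complex.exp (-(z * τ)) • K (max τ 0) y)) (z • R - y) 0 := by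
    refine (hd2.smul (hd1.const_sub R)).congr_deriv ?_
    simp
    abel
  have ht := (hasDerivAt_iff_tendsto_slope.1 hd).mono_left
    (nhdsWithin_mono 0 (fun s (hs : 0 < s) => hs.ne'))
  refine ht.congr' ?_
  filter_upwards [self_mem_nhdsWithin] with s hs
  rw [slope_def_module, semigroup_apply_semigroupLaplace_eq hK hM hz (le_of_lt hs) y]
  simp only [sub_zero, Complex.ofReal_zero, mul_zero, Complex.exp_zero,
    intervalIntegral.integral_same, one_smul]
  rw [← Complex.ofReal_inv, Complex.coe_smul]

/-- The Laplace transform is continuous and commutes with every `K s`, so it passes through the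
limit of difference quotients. This supplies the left inverse of z - A. -/
theorem semigroupLaplace_opApply (hA : IsGeneratorOf A K) {u : X} (hu : u ∈ A.domain) :
    semigroupLaplace K z (opApply A u) = opApply A (semigroupLaplace K z u) := by
  have h1 := (hA _ _).1 (semigroupLaplace_mem_graph hK hM hz hA u)
  have h2 := ((continuous_semigroupLaplace hK hM hz).tendsto _).comp (hA.tendsto hu)
  rw [(opApply_of_mem_graph (semigroupLaplace_mem_graph hK hM hz hA u)).2]
  refine tendsto_nhds_unique h2 (h1.congr' ?_)
  filter_upwards [self_mem_nhdsWithin] with s hs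
  rw [Function.comp_apply, semigroupLaplace_smul, semigroupLaplace_sub hK hM hz,
    semigroup_apply_semigroupLaplace hK hM hz (le_of_lt hs)]

theorem semigroupLaplace_sub_opApply (hA : IsGeneratorOf A K) {u : X} (hu : u ∈ A.domain) :
    semigroupLaplace K z (z • u - opApply A u) = u := by
  rw [semigroupLaplace_sub hK hM hz, semigroupLaplace_smul,
    semigroupLaplace_opApply hK hM hz hA hu,
    (opApply_of_mem_graph (semigroupLaplace_mem_graph hK hM hz hA u)).2]
  abel

omit hK hM hz [CompleteSpace X] in
theorem shiftOp_eq (u : A.domain) : shiftOp A z u = z • (u : X) - opApply A u := by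
  rw [shiftOp, opApply, dif_pos u.2]

theorem mem_opResolventSet_of_re_pos (hA : IsGeneratorOf A K) : z ∈ opResolventSet A := by
  refine ⟨fun u v huv => ?_, fun y => ?_⟩
  · rw [shiftOp_eq, shiftOp_eq] at huv
    refine Subtype.ext ?_
    rw [← semigroupLaplace_sub_opApply hK hM hz hA u.2, huv,
      semigroupLaplace_sub_opApply hK hM hz hA v.2]
  · obtain ⟨h1, h2⟩ := opApply_of_mem_graph (semigroupLaplace_mem_graph hK hM hz hA y)
    refine ⟨⟨_, h1⟩, ?_⟩
    rw [shiftOp_eq, h2]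
    simp

theorem opResolvent_eq_semigroupLaplace (hA : IsGeneratorOf A K) (y : X) :
    opResolvent A z y = semigroupLaplace K z y := by
  have hb := mem_opResolventSet_of_re_pos hK hM hz hA
  have h := Function.rightInverse_invFun hb.2 y
  rw [shiftOp_eq] at h
  rw [opResolvent]
  conv_rhs => rw [← h]
  exact (semigroupLaplace_sub_opApply hK hM hz hA (Subtype.mem _)).symm

end Laplace

/-- The generator only controls right derivatives. Subtracting ∫₀ˢ K(r)Au dr leaves a continuous
function with zero right derivative, hence a constant, and the resulting integral formula is
differentiable from both sides. -/
theorem hasDerivAt_orbit [CompleteSpace X] (hK : IsC0Semigroup K) (hA : IsGeneratorOf A K) {u : X}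
    (hu : u ∈ A.domain) {τ : ℝ} (hτ : 0 < τ) :
    HasDerivAt (fun s => K s u) (K τ (opApply A u)) τ := by
  have hφ := hK.continuous_orbit_max (opApply A u)
  have hI : ∀ s, HasDerivAt (fun s : ℝ => ∫ r in (0 : ℝ)..s, K (max r 0) (opApply A u))
      (K (max s 0) (opApply A u)) s := fun s => (hφ.integral_hasStrictDerivAt 0 s).hasDerivAt
  have hright : ∀ s, 0 ≤ s → HasDerivWithinAt (fun s => K s u) (K s (opApply A u)) (Set.Ici s) s := by
    intro s hs
    rw [← hasDerivWithinAt_Ioi_iff_Ici, hasDerivWithinAt_iff_tendsto_slope' Set.self_notMem_Ioi]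
    have h1 := ((K s).continuous.tendsto _).comp (hA.tendsto hu)
    have h2 : Tendsto (fun r : ℝ => r - s) (𝓝[>] s) (𝓝[>] 0) := by
      refine tendsto_nhdsWithin_iff.2 ⟨?_, ?_⟩
      · have : Tendsto (fun r : ℝ => r - s) (𝓝 s) (𝓝 (s - s)) := by
          exact (continuous_id.sub continuous_const).tendsto s
        rw [sub_self] at this
        exact this.mono_left nhdsWithin_le_nhds
      · filter_upwards [self_mem_nhdsWithin] with r (hr : s < r)
        exact sub_pos.2 hr
    refine (h1.comp h2).congr' ?_
    filter_upwards [self_mem_nhdsWithin] with r hr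
    have hr' : s < r := hr
    simp only [Function.comp_apply, map_smul, map_sub]
    rw [slope_def_module, ← hK.map_add_apply hs (by linarith), add_sub_cancel,
      ← Complex.ofReal_inv, Complex.coe_smul]
  have hconst : ∀ s, 0 ≤ s →
      K s u = u + ∫ r in (0 : ℝ)..s, K (max r 0) (opApply A u) := by
    intro s hs
    have := constant_of_has_deriv_right_zero
      (f := fun s => K s u - ∫ r in (0 : ℝ)..s, K (max r 0) (opApply A u)) (a := 0) (b := s)
      (((hK.continuous_orbit u).mono Set.Icc_subset_Ici_self).sub
        fun r _ => (hI r).continuousAt.continuousWithinAt) ?_ s ⟨hs, le_rfl⟩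
    · simp only [intervalIntegral.integral_same, sub_zero, hK.map_zero] at this
      rw [sub_eq_iff_eq_add] at this
      exact this
    · intro r hr
      have := (hright r hr.1).sub (hI r).hasDerivWithinAt
      rwa [max_eq_left hr.1, sub_self] at this
  have := (hI τ).const_add u
  rw [max_eq_left hτ.le] at this
  refine this.congr_of_eventuallyEq ?_
  filter_upwards [lt_mem_nhds hτ] with s hs
  exact hconst s hs.le

/-- `∫₀^∞ (τ^j / j!) e^{-zτ} K(τ) y dτ = (z - A)^{-(j+1)} y`. -/
noncomputable def resolventPowIntegral (K : ℝ → X →L[ℂ] X) (z : ℂ) (j : ℕ) (y : X) : X :=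
  ∫ τ in Set.Ioi (0 : ℝ), (((j.factorial : ℂ)⁻¹ * ((τ : ℂ) ^ j * Complex.exp (-(z * τ)))) • K τ y)

section Powers

variable [CompleteSpace X] (hK : IsC0Semigroup K) (hM : HasGrowthBound K M 0)
  (hA : IsGeneratorOf A K) {z : ℂ} (hz : 0 < z.re)

include hK hM hA hz

/-- Integrate the derivative of the weight of index j + 1 times the orbit of `u`; the power τ^{j+1}
kills the boundary term at 0 and the exponential the one at infinity. -/
theorem resolventPowIntegral_succ (j : ℕ) {u : X} (hu : u ∈ A.domain) :
    resolventPowIntegral K z (j + 1) (z • u - opApply A u) = resolventPowIntegral K z j u := by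
  set w : ℕ → ℝ → ℂ := fun j τ => (j.factorial : ℂ)⁻¹ * ((τ : ℂ) ^ j * Complex.exp (-(z * τ)))
    with hw
  have hwi : ∀ j, IntegrableOn (w j) (Set.Ioi 0) := fun j =>
    (integrableOn_pow_mul_cexp_neg_mul j hz).const_mul _
  have hint : ∀ j y, IntegrableOn (fun τ => w j τ • K τ y) (Set.Ioi 0) := fun j y =>
    hK.integrableOn_smul_orbit hM (hwi j) y
  have hwd : ∀ τ : ℝ, HasDerivAt (w (j + 1)) (w j τ - z * w (j + 1) τ) τ := by
    intro τ
    have h0 : HasDerivAt (fun σ : ℝ => (σ : ℂ)) 1 τ := Complex.ofRealCLM.hasDerivAt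
    refine (((h0.pow (j + 1)).mul (h0.const_mul z).neg.cexp).const_mul _).congr_deriv ?_
    have hj : (j.factorial : ℂ) ≠ 0 := by exact_mod_cast j.factorial_ne_zero
    have hj1 : (j + 1 : ℂ) ≠ 0 := by exact_mod_cast j.succ_ne_zero
    simp only [hw, Nat.factorial_succ]
    push_cast
    simp only [Pi.pow_apply, Pi.neg_apply]
    field_simp
    ring
  have hd : ∀ τ ∈ Set.Ioi (0 : ℝ), HasDerivAt (fun τ => w (j + 1) τ • K τ u)
      (w j τ • K τ u - w (j + 1) τ • K τ (z • u - opApply A u)) τ := by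
    intro τ hτ
    refine ((hwd τ).smul (hasDerivAt_orbit hK hA hu hτ)).congr_deriv ?_
    simp only [map_sub, map_smul, smul_sub, sub_smul, mul_smul]
    rw [smul_comm z]
    abel
  have hcont : ContinuousWithinAt (fun τ => w (j + 1) τ • K τ u) (Set.Ici 0) 0 :=
    (hwd 0).continuousAt.continuousWithinAt.smul (hK.continuous_orbit u 0 Set.self_mem_Ici)
  have hlim : Tendsto (fun τ => w (j + 1) τ • K τ u) atTop (𝓝 0) := by
    have h1 := (((tendsto_pow_mul_exp_neg_mul_atTop (j + 1) hz).const_mul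
      (((j + 1).factorial : ℝ)⁻¹)).mul_const (M * ‖u‖))
    rw [mul_zero, zero_mul] at h1
    refine squeeze_zero_norm' ?_ h1
    filter_upwards [eventually_ge_atTop 0] with τ hτ
    rw [norm_smul]
    refine mul_le_mul (le_of_eq ?_) (hM.norm_apply_le hτ u) (norm_nonneg _) (by positivity)
    rw [hw]
    simp only [norm_mul, norm_inv, norm_pow, Complex.norm_real, Real.norm_of_nonneg hτ,
      Complex.norm_exp, Complex.norm_natCast]
    simp
  have := integral_Ioi_of_hasDerivAt_of_tendsto hcont hd ((hint _ _).sub (hint _ _)) hlim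
  rw [integral_sub (hint _ _) (hint _ _)] at this
  simp [hw] at this
  rw [sub_eq_zero] at this
  rw [resolventPowIntegral, resolventPowIntegral]
  simp only [map_sub, map_smul]
  exact this.symm

theorem semigroupLaplace_mem_domain (u : X) :
    semigroupLaplace K z u ∈ A.domain :=
  (opApply_of_mem_graph (semigroupLaplace_mem_graph hK hM hz hA u)).1

end Powers

/-! ### Domains of powers of A -/

section PowDomain

theorem opApply_add {u v : X} (hu : u ∈ A.domain) (hv : v ∈ A.domain) :
    opApply A (u + v) = opApply A u + opApply A v :=
  (opApply_of_mem_graph (A.graph.add_mem (mem_graph_opApply hu) (mem_graph_opApply hv))).2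

theorem opApply_smul (c : ℂ) {u : X} (hu : u ∈ A.domain) :
    opApply A (c • u) = c • opApply A u :=
  (opApply_of_mem_graph (A.graph.smul_mem c (mem_graph_opApply hu))).2

theorem add_mem_powDomain {m : ℕ} {u v : X} (hu : u ∈ powDomain A m) (hv : v ∈ powDomain A m) :
    u + v ∈ powDomain A m := by
  induction m generalizing u v with
  | zero => trivial
  | succ m ih =>
    refine ⟨A.domain.add_mem hu.1 hv.1, ?_⟩
    rw [opApply_add hu.1 hv.1]
    exact ih hu.2 hv.2

theorem smul_mem_powDomain {m : ℕ} (c : ℂ) {u : X} (hu : u ∈ powDomain A m) :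
    c • u ∈ powDomain A m := by
  induction m generalizing u with
  | zero => trivial
  | succ m ih =>
    refine ⟨A.domain.smul_mem c hu.1, ?_⟩
    rw [opApply_smul c hu.1]
    exact ih hu.2

theorem powDomain_succ_subset (m : ℕ) : powDomain A (m + 1) ⊆ powDomain A m := by
  induction m with
  | zero => exact fun _ _ => trivial
  | succ m ih => exact fun u hu => ⟨hu.1, ih hu.2⟩

theorem smul_sub_opApply_mem_powDomain {m : ℕ} (z : ℂ) {u : X} (hu : u ∈ powDomain A (m + 1)) :
    z • u - opApply A u ∈ powDomain A m := by
  rw [sub_eq_add_neg, ← neg_one_smul ℂ (opApply A u)]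
  exact add_mem_powDomain (smul_mem_powDomain z (powDomain_succ_subset m hu))
    (smul_mem_powDomain _ hu.2)

theorem zero_mem_powDomain (m : ℕ) : (0 : X) ∈ powDomain A m := by
  induction m with
  | zero => trivial
  | succ m ih =>
    refine ⟨A.domain.zero_mem, ?_⟩
    rwa [(opApply_of_mem_graph A.graph.zero_mem).2]

/-- Membership is needed: `opApply` takes the default value 0 off D(A), so it is additive only on
the domain. -/
theorem shiftPow_add {m : ℕ} (z : ℂ) {u v : X} (hu : u ∈ powDomain A m)
    (hv : v ∈ powDomain A m) :
    shiftPow A z m (u + v) = shiftPow A z m u + shiftPow A z m v := by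
  induction m generalizing u v with
  | zero => rfl
  | succ m ih =>
    rw [shiftPow, shiftPow, shiftPow, ← ih (smul_sub_opApply_mem_powDomain z hu)
      (smul_sub_opApply_mem_powDomain z hv), opApply_add hu.1 hv.1]
    congr 1
    rw [smul_add]
    abel

theorem shiftPow_smul {m : ℕ} (z c : ℂ) {u : X} (hu : u ∈ powDomain A m) :
    shiftPow A z m (c • u) = c • shiftPow A z m u := by
  induction m generalizing u with
  | zero => rfl
  | succ m ih =>
    rw [shiftPow, shiftPow, ← ih (smul_sub_opApply_mem_powDomain z hu), opApply_smul c hu.1,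
      smul_sub, smul_comm]

theorem sum_mem_powDomain_and_shiftPow_sum {ι : Type*} (s : Finset ι) {m : ℕ} (z : ℂ) {f : ι → X}
    (hf : ∀ i, f i ∈ powDomain A m) :
    ∑ i ∈ s, f i ∈ powDomain A m ∧
      shiftPow A z m (∑ i ∈ s, f i) = ∑ i ∈ s, shiftPow A z m (f i) := by
  classical
  induction s using Finset.induction_on with
  | empty =>
    refine ⟨by simpa using zero_mem_powDomain m, ?_⟩
    have := shiftPow_smul z 0 (zero_mem_powDomain (A := A) m)
    simpa using this
  | insert i s hi ih =>
    rw [Finset.sum_insert hi, Finset.sum_insert hi]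
    exact ⟨add_mem_powDomain (hf i) ih.1, by rw [shiftPow_add z (hf i) ih.1, ih.2]⟩

/-- This lets (2δ - A)^m move through each resolvent of the trapezoidal sum, from the outside onto
`x`. -/
theorem semigroupLaplace_mem_powDomain_and_shiftPow [CompleteSpace X] (hK : IsC0Semigroup K)
    (hM : HasGrowthBound K M 0) (hA : IsGeneratorOf A K) {z : ℂ} (hz : 0 < z.re) (w : ℂ) {m : ℕ}
    {u : X} (hu : u ∈ powDomain A m) :
    semigroupLaplace K z u ∈ powDomain A m ∧
      shiftPow A w m (semigroupLaplace K z u) = semigroupLaplace K z (shiftPow A w m u) := by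
  induction m generalizing u with
  | zero => exact ⟨trivial, rfl⟩
  | succ m ih =>
    have h := semigroupLaplace_opApply hK hM hz hA hu.1
    refine ⟨⟨semigroupLaplace_mem_domain hK hM hA hz u, ?_⟩, ?_⟩
    · rw [← h]
      exact (ih hu.2).1
    · rw [shiftPow, shiftPow, ← (ih (smul_sub_opApply_mem_powDomain w hu)).2, ← h,
        semigroupLaplace_sub hK hM hz, semigroupLaplace_smul]

theorem resolventPowIntegral_shiftPow [CompleteSpace X] (hK : IsC0Semigroup K)
    (hM : HasGrowthBound K M 0) (hA : IsGeneratorOf A K) {z : ℂ} (hz : 0 < z.re) (m j : ℕ)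
    {u : X} (hu : u ∈ powDomain A m) :
    resolventPowIntegral K z (m + j) (shiftPow A z m u) = resolventPowIntegral K z j u := by
  induction m generalizing u j with
  | zero => rw [zero_add]; rfl
  | succ m ih =>
    rw [shiftPow, add_right_comm, add_assoc, ih (j + 1) (smul_sub_opApply_mem_powDomain z hu),
      resolventPowIntegral_succ hK hM hA hz j hu.1]

theorem resolventPowIntegral_shiftPow_succ [CompleteSpace X] (hK : IsC0Semigroup K)
    (hM : HasGrowthBound K M 0) (hA : IsGeneratorOf A K) {z : ℂ} (hz : 0 < z.re) (m : ℕ)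
    {u : X} (hu : u ∈ powDomain A (m + 1)) :
    resolventPowIntegral K z m (shiftPow A z (m + 1) u) = u := by
  rw [shiftPow]
  have h := resolventPowIntegral_shiftPow hK hM hA hz m 0 (smul_sub_opApply_mem_powDomain z hu)
  rw [add_zero] at h
  rw [h]
  conv_rhs => rw [← semigroupLaplace_sub_opApply hK hM hz hA hu.1]
  simp only [resolventPowIntegral, semigroupLaplace, Nat.factorial_zero, Nat.cast_one, inv_one,
    one_mul, pow_zero]

end PowDomain

end Semigroup

/-! ### Contour integral, trapezoidal series and discretization error -/

section Contour

variable {X : Type*} [NormedAddCommGroup X] [NormedSpace ℂ X] [CompleteSpace X]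
  {A : X →ₗ.[ℂ] X} {K : ℝ → X →L[ℂ] X} {M : ℝ}
  (hK : IsC0Semigroup K) (hM : HasGrowthBound K M 0) (hA : IsGeneratorOf A K)
  (k : ℕ) {δ : ℝ} (hδ : 0 < δ)

theorem contourPoint_re (δ s : ℝ) : (contourPoint δ s).re = δ := by
  simp [contourPoint]

omit [CompleteSpace X] in
include hδ in
theorem continuous_contourKernel (v : ℝ) : Continuous (contourKernel k δ v) := by
  rw [show contourKernel k δ v = _ from funext (contourKernel_eq k δ v)]
  refine Continuous.mul (by fun_prop) (Continuous.mul (Continuous.inv₀ (by fun_prop) fun s =>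
    pow_ne_zero _ ?_) (by fun_prop))
  intro h
  have := congrArg Complex.re h
  simp at this
  exact hδ.ne' this

include hK hM hA hδ

theorem contourIntegrand_eq_smul_semigroupLaplace (t : ℝ) (y : X) (s : ℝ) :
    contourIntegrand A δ t (2 * (k + 1)) y s =
      contourKernel k δ t s • semigroupLaplace K (contourPoint δ s) y := by
  rw [contourIntegrand, opResolvent_eq_semigroupLaplace hK hM (by rwa [contourPoint_re]) hA]
  rfl

theorem contourIntegrand_eq_integral (t : ℝ) (y : X) (s : ℝ) :
    contourIntegrand A δ t (2 * (k + 1)) y s =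
      ∫ τ in Set.Ioi (0 : ℝ), contourKernel k δ (t - τ) s • K τ y := by
  rw [contourIntegrand_eq_smul_semigroupLaplace hK hM hA k hδ, semigroupLaplace, ← integral_smul]
  refine setIntegral_congr_fun measurableSet_Ioi fun τ _ => ?_
  rw [smul_smul, sub_eq_add_neg, contourKernel_add]
  congr 3
  push_cast
  ring

theorem norm_contourIntegrand_le (t : ℝ) (y : X) (s : ℝ) :
    ‖contourIntegrand A δ t (2 * (k + 1)) y s‖ ≤
      M * Real.exp (δ * t) * ‖y‖ / δ * ((δ ^ 2 + s ^ 2) ^ (k + 1))⁻¹ := by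
  rw [contourIntegrand_eq_smul_semigroupLaplace hK hM hA k hδ, norm_smul, norm_contourKernel]
  have h := norm_semigroupLaplace_le hM (z := contourPoint δ s) (by rwa [contourPoint_re]) y
  rw [contourPoint_re] at h
  refine (mul_le_mul_of_nonneg_left h (by positivity)).trans_eq ?_
  ring

omit hA [CompleteSpace X] in
theorem integrable_contourKernel_smul_prod {S : Type*} [MeasurableSpace S] {μ : Measure S}
    [SFinite μ] {σ : S → ℝ} (hσ : Measurable σ)
    (hμ : Integrable (fun i => ((δ ^ 2 + σ i ^ 2) ^ (k + 1))⁻¹) μ) (t : ℝ) (y : X) :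
    Integrable (fun q : S × ℝ => contourKernel k δ (t - q.2) (σ q.1) • K q.2 y)
      (μ.prod (volume.restrict (Set.Ioi 0))) := by
  have hexp : IntegrableOn (fun τ : ℝ => Real.exp (-δ * τ) * (Real.exp (δ * t) * (M * ‖y‖)))
      (Set.Ioi 0) :=
    (integrableOn_exp_mul_Ioi (a := -δ) (by linarith) 0).mul_const _
  refine (hμ.mul_prod hexp).mono' ?_ ?_
  · refine AEStronglyMeasurable.smul ?_ (hK.aestronglyMeasurable_orbit y).comp_snd
    have e : (fun q : S × ℝ => contourKernel k δ (t - q.2) (σ q.1)) =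
        fun q => contourKernel k δ t (σ q.1) *
          Complex.exp (contourPoint δ (σ q.1) * (-q.2 : ℝ)) := by
      ext q
      rw [sub_eq_add_neg, contourKernel_add]
    rw [e]
    have hs : Measurable fun q : S × ℝ => σ q.1 := hσ.comp measurable_fst
    have h1 : Measurable fun q : S × ℝ => contourKernel k δ t (σ q.1) :=
      (continuous_contourKernel k hδ t).measurable.comp hs
    have h2 : Measurable fun q : S × ℝ => contourPoint δ (σ q.1) := by
      unfold contourPoint; fun_prop
    have h3 : Measurable fun q : S × ℝ => ((-q.2 : ℝ) : ℂ) := by fun_prop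
    exact (h1.mul (h2.mul h3).cexp).aestronglyMeasurable
  · have hq : ∀ᵐ q : S × ℝ ∂(μ.prod (volume.restrict (Set.Ioi 0))), q.2 ∈ Set.Ioi (0 : ℝ) :=
      Measure.quasiMeasurePreserving_snd.ae (ae_restrict_mem measurableSet_Ioi)
    filter_upwards [hq] with q hq
    rw [norm_smul, norm_contourKernel]
    refine (mul_le_mul_of_nonneg_left (hM.norm_apply_le (le_of_lt hq) y) (by positivity)).trans_eq ?_
    rw [show δ * (t - q.2) = -δ * q.2 + δ * t by ring, Real.exp_add]
    ring

/-- One application of Fubini serves both cases: Lebesgue measure yields the contour integral,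
counting measure on ℤ the trapezoidal series. -/
theorem integral_contourIntegrand {S : Type*} [MeasurableSpace S] {μ : Measure S}
    [SFinite μ] {σ : S → ℝ} (hσ : Measurable σ)
    (hμ : Integrable (fun i => ((δ ^ 2 + σ i ^ 2) ^ (k + 1))⁻¹) μ) (t : ℝ) (y : X) :
    Integrable (fun i => contourIntegrand A δ t (2 * (k + 1)) y (σ i)) μ ∧
    IntegrableOn (fun τ => (∫ i, contourKernel k δ (t - τ) (σ i) ∂μ) • K τ y) (Set.Ioi 0) ∧
    ∫ i, contourIntegrand A δ t (2 * (k + 1)) y (σ i) ∂μ =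
      ∫ τ in Set.Ioi (0 : ℝ), (∫ i, contourKernel k δ (t - τ) (σ i) ∂μ) • K τ y := by
  have hp := integrable_contourKernel_smul_prod hK hM k hδ hσ hμ t y
  simp_rw [contourIntegrand_eq_integral hK hM hA k hδ]
  refine ⟨hp.integral_prod_left, ?_, ?_⟩
  · have := hp.integral_prod_right
    simp only [integral_smul_const] at this
    exact this
  · rw [integral_integral_swap hp]
    simp only [integral_smul_const]

theorem integrable_contourIntegrand (t : ℝ) (y : X) :
    Integrable (contourIntegrand A δ t (2 * (k + 1)) y) :=
  (integral_contourIntegrand hK hM hA k hδ measurable_id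
    (integrable_inv_sq_add_sq_pow k hδ) t y).1

theorem contourIntegral_eq_integral (t : ℝ) (y : X) :
    IntegrableOn (fun τ => ((1 / (2 * Real.pi) : ℂ) *
      ∫ s : ℝ, contourKernel k δ (t - τ) s) • K τ y) (Set.Ioi 0) ∧
    contourIntegral A δ t (2 * (k + 1)) y = ∫ τ in Set.Ioi (0 : ℝ),
      ((1 / (2 * Real.pi) : ℂ) * ∫ s : ℝ, contourKernel k δ (t - τ) s) • K τ y := by
  obtain ⟨-, h2, h3⟩ := integral_contourIntegrand hK hM hA k hδ measurable_id
    (integrable_inv_sq_add_sq_pow k hδ) t y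
  simp only [id] at h2 h3
  simp_rw [mul_smul]
  refine ⟨Integrable.smul (1 / (2 * Real.pi) : ℂ) h2, ?_⟩
  rw [contourIntegral, h3, integral_smul, ← Complex.coe_smul]
  push_cast
  rfl

theorem trapSeries_eq_integral {h : ℝ}
    (hsum : Summable fun j : ℤ => ((δ ^ 2 + (h * j) ^ 2) ^ (k + 1))⁻¹) (t : ℝ) (y : X) :
    IntegrableOn (fun τ => ((h / (2 * Real.pi) : ℂ) *
      ∑' j : ℤ, contourKernel k δ (t - τ) (h * j)) • K τ y) (Set.Ioi 0) ∧
    trapSeries A δ t h (2 * (k + 1)) y = ∫ τ in Set.Ioi (0 : ℝ),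
      ((h / (2 * Real.pi) : ℂ) * ∑' j : ℤ, contourKernel k δ (t - τ) (h * j)) • K τ y := by
  have hc : Integrable (fun j : ℤ => ((δ ^ 2 + (h * j) ^ 2) ^ (k + 1))⁻¹) Measure.count :=
    integrable_count_iff.2 hsum.norm
  obtain ⟨h1, h2, h3⟩ := integral_contourIntegrand hK hM hA k hδ
    (σ := fun j : ℤ => h * (j : ℝ)) (measurable_of_countable _) hc t y
  have e : ∀ τ : ℝ, ∫ j : ℤ, contourKernel k δ (t - τ) (h * j) ∂Measure.count =
      ∑' j : ℤ, contourKernel k δ (t - τ) (h * j) := by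
    intro τ
    rw [integral_countable]
    · simp
    · refine integrable_count_iff.2 ?_
      simp_rw [norm_contourKernel]
      exact hsum.mul_left _
  rw [integral_countable h1] at h3
  simp only [e] at h2 h3
  simp at h3
  simp_rw [mul_smul]
  refine ⟨Integrable.smul (h / (2 * Real.pi) : ℂ) h2, ?_⟩
  rw [trapSeries, h3, integral_smul, ← Complex.coe_smul]
  push_cast
  rfl

/-- At v = t - τ the scalar integral gives the weight (τ - t)₊^{m-1} e^{-2δ(τ - t)}/(m-1)!. After
the shift τ ↦ τ + t, `K t` factors out of the integral formula for (2δ - A)^{-m} y = x. -/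
theorem contourIntegral_eq_semigroup {t : ℝ} (ht : 0 ≤ t) {x : X}
    (hx : x ∈ powDomain A (2 * (k + 1))) :
    contourIntegral A δ t (2 * (k + 1)) (shiftPow A (2 * (δ : ℂ)) (2 * (k + 1)) x) = K t x := by
  set y := shiftPow A (2 * (δ : ℂ)) (2 * (k + 1)) x
  have hz : 0 < (2 * (δ : ℂ)).re := by simpa using hδ
  have hpi' : (2 * Real.pi : ℂ) ≠ 0 := by simp [Real.pi_ne_zero]
  have hxy : resolventPowIntegral K (2 * (δ : ℂ)) (2 * k + 1) y = x :=
    resolventPowIntegral_shiftPow_succ hK hM hA hz (2 * k + 1) hx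
  rw [(contourIntegral_eq_integral hK hM hA k hδ t y).2]
  set g : ℝ → X := fun τ =>
    ((Real.exp (δ * (t - τ)) * gammaKernel k δ (τ - t) : ℝ) : ℂ) • K τ y with hg
  have e1 : ∀ τ : ℝ, ((1 / (2 * Real.pi) : ℂ) * ∫ s : ℝ, contourKernel k δ (t - τ) s) • K τ y =
      g τ := by
    intro τ
    rw [integral_contourKernel k hδ, one_div, inv_mul_cancel_left₀ hpi', neg_sub]
  simp_rw [e1]
  have e2 : ∫ τ in Set.Ioi (0 : ℝ), g τ = ∫ τ in Set.Ioi t, g τ := by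
    refine setIntegral_eq_of_subset_of_forall_sdiff_eq_zero measurableSet_Ioi
      (Set.Ioi_subset_Ioi ht) ?_
    rintro τ ⟨-, h2⟩
    simp only [hg]
    rw [gammaKernel_of_nonpos k δ (sub_nonpos.2 (not_lt.1 h2))]
    simp
  rw [e2, ← integral_Ioi_comp_add_right, ← hxy, resolventPowIntegral,
    ← (K t).integral_comp_comm (hK.integrableOn_smul_orbit hM
      ((integrableOn_pow_mul_cexp_neg_mul (2 * k + 1) hz).const_mul _) y)]
  refine setIntegral_congr_fun measurableSet_Ioi fun τ hτ => ?_
  simp only [hg, map_smul]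
  rw [← hK.map_add_apply ht (le_of_lt hτ), add_comm t τ, add_sub_cancel_right,
    gammaKernel_of_nonneg k δ (le_of_lt hτ)]
  congr 1
  push_cast
  rw [mul_left_comm, mul_left_comm (Complex.exp _), ← Complex.exp_add]
  congr 3
  ring_nf

theorem norm_contourIntegral_sub_trapSeries_le {h : ℝ} (hh : 0 < h)
    (hsum : Summable fun j : ℤ => ((δ ^ 2 + (h * j) ^ 2) ^ (k + 1))⁻¹) {t : ℝ} (ht : 0 ≤ t) (y : X) :
    ‖contourIntegral A δ t (2 * (k + 1)) y - trapSeries A δ t h (2 * (k + 1)) y‖ ≤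
      gammaKernelBound k δ * (Real.exp (δ * Real.pi / h) - 1)⁻¹ * (M * ‖y‖) *
        (4 / δ * Real.exp (3 * δ * t / 2)) := by
  obtain ⟨i1, e1⟩ := contourIntegral_eq_integral hK hM hA k hδ t y
  obtain ⟨i2, e2⟩ := trapSeries_eq_integral hK hM hA k hδ hsum t y
  rw [e1, e2, ← integral_sub i1 i2]
  simp_rw [← sub_smul]
  have hM0 : 0 ≤ M := (norm_nonneg _).trans (hM.norm_le le_rfl)
  have hE : 0 < Real.exp (δ * Real.pi / h) - 1 := by
    have : 0 < δ * Real.pi / h := by have := Real.pi_pos; positivity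
    linarith [Real.one_lt_exp_iff.2 this]
  have hG := gammaKernelBound_nonneg k hδ
  set B := gammaKernelBound k δ * (Real.exp (δ * Real.pi / h) - 1)⁻¹
  have hB : 0 ≤ B := by positivity
  have j1 := integrableOn_exp_mul_Ioi (a := -(3 * δ / 2)) (by linarith) 0
  have j2 := integrableOn_exp_mul_Ioi (a := -(δ / 2)) (by linarith) 0
  have hint : IntegrableOn (fun τ : ℝ => B * (M * ‖y‖) *
      (Real.exp (3 * δ * t / 2) * Real.exp (-(3 * δ / 2) * τ) +
        Real.exp (δ * t / 2) * Real.exp (-(δ / 2) * τ))) (Set.Ioi 0) :=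
    ((j1.const_mul _).add (j2.const_mul _)).const_mul _
  refine (norm_integral_le_of_norm_le hint ?_).trans ?_
  · filter_upwards [ae_restrict_mem measurableSet_Ioi] with τ hτ
    rw [norm_smul]
    refine (mul_le_mul (norm_integral_sub_tsum_contourKernel_le k hδ hh (t - τ))
      (hM.norm_apply_le (le_of_lt hτ) y) (norm_nonneg _) (by positivity)).trans_eq ?_
    rw [← Real.exp_add, ← Real.exp_add,
      show 3 * δ * (t - τ) / 2 = 3 * δ * t / 2 + -(3 * δ / 2) * τ by ring,
      show δ * (t - τ) / 2 = δ * t / 2 + -(δ / 2) * τ by ring]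
    ring
  · rw [integral_const_mul, integral_add (j1.const_mul _) (j2.const_mul _), integral_const_mul,
      integral_const_mul, integral_exp_mul_Ioi (by linarith), integral_exp_mul_Ioi (by linarith)]
    refine mul_le_mul_of_nonneg_left ?_ (by positivity)
    have hle : Real.exp (δ * t / 2) ≤ Real.exp (3 * δ * t / 2) :=
      Real.exp_le_exp.2 (by nlinarith [mul_nonneg hδ.le ht])
    simp only [mul_zero, Real.exp_zero]
    -- The two exponentials integrate to 2/(3δ) and 2/δ; their sum 8/(3δ) is rounded up to 4/δ.
    have c1 : -(1 : ℝ) / -(3 * δ / 2) = 2 / 3 * (1 / δ) := by field_simp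
    have c2 : -(1 : ℝ) / -(δ / 2) = 2 * (1 / δ) := by field_simp
    rw [c1, c2, show 4 / δ = 4 * (1 / δ) by ring]
    have : 0 < 1 / δ := by positivity
    nlinarith [Real.exp_pos (3 * δ * t / 2), mul_le_mul_of_nonneg_left hle this.le,
      mul_pos this (Real.exp_pos (3 * δ * t / 2))]

end Contour

/-! ### Truncation error and closed forms of the bounds -/

theorem antitoneOn_inv_sq_add_sq_pow (k : ℕ) {δ h : ℝ} (hδ : 0 < δ) (hh : 0 < h) :
    AntitoneOn (fun u : ℝ => ((δ ^ 2 + (h * u) ^ 2) ^ (k + 1))⁻¹) (Set.Ici 0) := by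
  intro u hu v hv huv
  have hu' : 0 ≤ u := hu
  refine inv_anti₀ (by positivity) ?_
  gcongr

theorem integrable_inv_sq_add_sq_pow_mul (k : ℕ) {δ h : ℝ} (hδ : 0 < δ) (hh : 0 < h) :
    Integrable (fun u : ℝ => ((δ ^ 2 + (h * u) ^ 2) ^ (k + 1))⁻¹) :=
  (integrable_inv_sq_add_sq_pow k hδ).comp_mul_left' hh.ne'

theorem summable_nat_inv_sq_add_sq_pow (k : ℕ) {δ h : ℝ} (hδ : 0 < δ) (hh : 0 < h) :
    Summable fun n : ℕ => ((δ ^ 2 + (h * n) ^ 2) ^ (k + 1))⁻¹ :=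
  (antitoneOn_inv_sq_add_sq_pow k hδ hh).summable_of_integrableOn_Ioi_zero
    (integrable_inv_sq_add_sq_pow_mul k hδ hh).integrableOn fun u _ => by positivity

theorem summable_int_inv_sq_add_sq_pow (k : ℕ) {δ h : ℝ} (hδ : 0 < δ) (hh : 0 < h) :
    Summable fun j : ℤ => ((δ ^ 2 + (h * j) ^ 2) ^ (k + 1))⁻¹ := by
  have := summable_nat_inv_sq_add_sq_pow k hδ hh
  refine Summable.of_nat_of_neg ?_ ?_ <;> simpa using this

/-- The first omitted node is N + 1; by monotonicity each term is at most the integral over the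
preceding unit interval, so the tail integral starts at `N`. -/
theorem tsum_nat_tail_le (k : ℕ) {δ h : ℝ} (hδ : 0 < δ) (hh : 0 < h) (N : ℕ) :
    ∑' n : ℕ, ((δ ^ 2 + (h * (n + N + 1 : ℕ)) ^ 2) ^ (k + 1))⁻¹ ≤
      h⁻¹ * ((δ ^ (2 * k + 1))⁻¹ *
        ∫ u in Set.Ioi (h * N / δ), ((1 + u ^ 2) ^ (k + 1))⁻¹) := by
  refine (((antitoneOn_inv_sq_add_sq_pow k hδ hh).mono (Set.Ici_subset_Ici.2
    N.cast_nonneg)).tsum_comp_add_le_integral N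
    (integrable_inv_sq_add_sq_pow_mul k hδ hh).integrableOn fun u _ => by positivity).trans_eq ?_
  rw [integral_comp_mul_left_Ioi (fun s : ℝ => ((δ ^ 2 + s ^ 2) ^ (k + 1))⁻¹) _ hh,
    integral_Ioi_inv_sq_add_sq_pow k hδ, smul_eq_mul]

theorem sum_Icc_neg_eq_sum_range {E : Type*} [AddCommGroup E] (f : ℤ → E) (N : ℕ) :
    ∑ j ∈ Finset.Icc (-(N : ℤ)) N, f j =
      (∑ n ∈ Finset.range N, f (n + 1)) + f 0 + ∑ n ∈ Finset.range N, f (-(n + 1)) := by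
  induction N with
  | zero => simp
  | succ N ih =>
    have e : Finset.Icc (-((N + 1 : ℕ) : ℤ)) ((N + 1 : ℕ) : ℤ) =
        insert ((N : ℤ) + 1) (insert (-((N : ℤ) + 1)) (Finset.Icc (-(N : ℤ)) N)) := by
      ext j
      simp only [Finset.mem_Icc, Finset.mem_insert]
      omega
    rw [e, Finset.sum_insert, Finset.sum_insert, ih, Finset.sum_range_succ, Finset.sum_range_succ]
    · abel
    · simp
    · simp only [Finset.mem_insert, Finset.mem_Icc]
      omega

theorem norm_tsum_sub_sum_Icc_le {E : Type*} [NormedAddCommGroup E] [CompleteSpace E]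
    {f : ℤ → E} {g : ℕ → ℝ} (hg : Summable g) (hf : ∀ j : ℤ, ‖f j‖ ≤ g j.natAbs) (N : ℕ) :
    ‖∑' j, f j - ∑ j ∈ Finset.Icc (-(N : ℤ)) N, f j‖ ≤ 2 * ∑' n : ℕ, g (n + N + 1) := by
  have b1 : ∀ n : ℕ, ‖f (n + 1)‖ ≤ g (n + 1) := fun n => hf (n + 1)
  have b2 : ∀ n : ℕ, ‖f (-(n + 1))‖ ≤ g (n + 1) := fun n => by
    have := hf (-(n + 1)); rw [Int.natAbs_neg] at this; exact this
  have hg1 : Summable fun n => g (n + 1) := (summable_nat_add_iff 1).2 hg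
  have hgN : Summable fun n => g (n + N + 1) := (summable_nat_add_iff N).2 hg1
  have s1 : Summable fun n : ℕ => f (n + 1) := Summable.of_norm_bounded hg1 b1
  have s2 : Summable fun n : ℕ => f (-(n + 1)) := Summable.of_norm_bounded hg1 b2
  rw [tsum_of_add_one_of_neg_add_one s1 s2, sum_Icc_neg_eq_sum_range,
    ← s1.sum_add_tsum_nat_add N, ← s2.sum_add_tsum_nat_add N]
  have e1 := tsum_of_norm_bounded hgN.hasSum (fun n => b1 (n + N))
  have e2 := tsum_of_norm_bounded hgN.hasSum (fun n => b2 (n + N))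
  have h3 : ∀ a b c d e : E, a + b + e + (c + d) - (a + e + c) = b + d := by
    intros; abel
  rw [add_assoc, ← add_assoc, h3, two_mul]
  exact (norm_add_le _ _).trans (add_le_add e1 e2)

theorem gamma_bracket_eq_integral (k : ℕ) :
    Real.Gamma (3 / 2) * Real.Gamma ((((2 * (k + 1) : ℕ) : ℝ) - 1) / 2) /
      Real.Gamma (((2 * (k + 1) : ℕ) : ℝ) / 2) =
      ∫ u in Set.Ioi (0 : ℝ), ((1 + u ^ 2) ^ (k + 1))⁻¹ := by
  rw [integral_Ioi_inv_one_add_sq_pow]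
  congr 3
  · push_cast; ring
  · push_cast; ring

theorem truncationBound_eq (M δ t h : ℝ) (k N : ℕ) (Y : ℝ) :
    truncationBound M δ t h (2 * (k + 1)) N Y =
      M * Real.exp (δ * t) * Y / (Real.pi * δ ^ (2 * (k + 1))) *
        ∫ u in Set.Ioi (h * N / δ), ((1 + u ^ 2) ^ (k + 1))⁻¹ := by
  rw [← gamma_sub_hypergeometric_eq_tail, truncationBound]
  have e1 : (((2 * (k + 1) : ℕ) : ℝ) - 1) / 2 = k + 1 / 2 := by push_cast; ring
  have e2 : ((2 * (k + 1) : ℕ) : ℝ) / 2 = ((k + 1 : ℕ) : ℝ) := by push_cast; ring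
  rw [e1, e2]
  have e3 : Real.Gamma ((k + 1 : ℕ) : ℝ) = Real.Gamma (k + 1) := by push_cast; rfl
  rw [e3, mul_comm Real.pi (Real.Gamma _), mul_comm Real.pi δ, ← div_div, ← div_div (h * N)]
  ring

/-- The constant 2^{m+1}/δ^m is the product of (2/δ)^{m-1} from `gammaKernelBound` and 4/δ from the
integration over τ. -/
theorem discretizationBound_eq (M δ t h : ℝ) (k : ℕ) (Y : ℝ) :
    discretizationBound M δ t h (2 * (k + 1)) Y =
      gammaKernelBound k δ * (Real.exp (δ * Real.pi / h) - 1)⁻¹ * (M * Y) *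
        (4 / δ * Real.exp (3 * δ * t / 2)) := by
  rw [discretizationBound, gammaKernelBound, ← gamma_bracket_eq_integral]
  generalize Real.Gamma _ = a
  generalize Real.Gamma ((((2 * (k + 1) : ℕ) : ℝ) - 1) / 2) = b
  generalize Real.Gamma (((2 * (k + 1) : ℕ) : ℝ) / 2) = c
  generalize Real.exp (δ * Real.pi / h) - 1 = d
  have e : (2 : ℝ) ^ (2 * (k + 1) + 1) = 4 * 2 ^ (2 * k + 1) := by
    rw [show 2 * (k + 1) + 1 = 2 * k + 1 + 2 by ring, pow_add]; ring
  have e' : δ ^ (2 * (k + 1)) = δ * δ ^ (2 * k + 1) := by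
    rw [show 2 * (k + 1) = 2 * k + 1 + 1 by ring, pow_succ]; ring
  rw [e, e', div_pow, inv_div]
  simp only [div_eq_mul_inv, mul_inv]
  ring

theorem truncationBound_isEquivalent (M t : ℝ) {δ h : ℝ} (hδ : 0 < δ) (hh : 0 < h) (k : ℕ)
    (Y : ℝ) :
    (fun N : ℕ => truncationBound M δ t h (2 * (k + 1)) N Y) ~[atTop]
      fun N : ℕ => M * Real.exp (δ * t) / (Real.pi * δ ^ (2 * (k + 1))) *
        (1 / (((2 * (k + 1) : ℕ) : ℝ) - 1) * (δ / (h * (N : ℝ))) ^ (2 * (k + 1) - 1)) * Y := by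
  have ht : Tendsto (fun N : ℕ => h * (N : ℝ) / δ) atTop atTop :=
    (tendsto_natCast_atTop_atTop.const_mul_atTop hh).atTop_div_const hδ
  have h1 := ((tail_isEquivalent k).comp_tendsto ht)
  -- The constant factor may vanish, for instance when `Y` is 0; multiplying equivalences avoids
  -- dividing by it.
  have h2 := (IsEquivalent.refl (u := fun _ : ℕ =>
    M * Real.exp (δ * t) * Y / (Real.pi * δ ^ (2 * (k + 1)))) (l := atTop)).mul h1
  refine (h2.congr_left ?_).congr_right ?_
  · exact Eventually.of_forall fun N => (truncationBound_eq M δ t h k N Y).symm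
  · refine Eventually.of_forall fun N => ?_
    simp only [Pi.mul_apply, Function.comp_apply]
    rw [inv_div, show 2 * (k + 1) - 1 = 2 * k + 1 by omega,
      show ((2 * (k + 1) : ℕ) : ℝ) - 1 = 2 * k + 1 by push_cast; ring]
    ring

section Truncation

variable {X : Type*} [NormedAddCommGroup X] [NormedSpace ℂ X] [CompleteSpace X]
  {A : X →ₗ.[ℂ] X} {K : ℝ → X →L[ℂ] X} {M : ℝ}
  (hK : IsC0Semigroup K) (hM : HasGrowthBound K M 0) (hA : IsGeneratorOf A K)
  (k : ℕ) {δ h : ℝ} (hδ : 0 < δ) (hh : 0 < h)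

include hK hM hA hδ hh

theorem summable_norm_contourIntegrand (t : ℝ) (y : X) :
    Summable fun j : ℤ => ‖contourIntegrand A δ t (2 * (k + 1)) y (h * (j : ℝ))‖ :=
  Summable.of_nonneg_of_le (fun _ => norm_nonneg _)
    (fun j => norm_contourIntegrand_le hK hM hA k hδ t y (h * j))
    ((summable_int_inv_sq_add_sq_pow k hδ hh).mul_left _)

theorem norm_trapSeries_sub_trapSum_le (t : ℝ) (y : X) (N : ℕ) :
    ‖trapSeries A δ t h (2 * (k + 1)) y - trapSum A δ t h (2 * (k + 1)) N y‖ ≤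
      truncationBound M δ t h (2 * (k + 1)) N ‖y‖ := by
  have hpi := Real.pi_pos
  have hM0 : 0 ≤ M := (norm_nonneg _).trans (hM.norm_le le_rfl)
  have key := norm_tsum_sub_sum_Icc_le
    (f := fun j : ℤ => contourIntegrand A δ t (2 * (k + 1)) y (h * (j : ℝ)))
    (g := fun n : ℕ => M * Real.exp (δ * t) * ‖y‖ / δ * ((δ ^ 2 + (h * n) ^ 2) ^ (k + 1))⁻¹)
    ((summable_nat_inv_sq_add_sq_pow k hδ hh).mul_left _) (fun j => by
      refine (norm_contourIntegrand_le hK hM hA k hδ t y (h * j)).trans_eq ?_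
      have : ((j.natAbs : ℕ) : ℝ) = |(j : ℝ)| := by
        rw [Nat.cast_natAbs, Int.cast_abs]
      simp only [this, mul_pow, sq_abs]) N
  rw [trapSeries, trapSum, ← smul_sub, norm_smul, Real.norm_of_nonneg (by positivity),
    truncationBound_eq]
  refine (mul_le_mul_of_nonneg_left key (by positivity)).trans ?_
  rw [tsum_mul_left]
  refine (mul_le_mul_of_nonneg_left (mul_le_mul_of_nonneg_left (mul_le_mul_of_nonneg_left
    (tsum_nat_tail_le k hδ hh N) (by positivity)) zero_le_two) (by positivity)).trans_eq ?_
  generalize (∫ u in Set.Ioi (h * N / δ), ((1 + u ^ 2) ^ (k + 1))⁻¹) = T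
  rw [show 2 * (k + 1) = 2 * k + 1 + 1 by ring, pow_succ]
  field_simp
  ring

omit hh in
theorem trapSum_mem_powDomain_and_trapApprox (t : ℝ) (N : ℕ) {x : X}
    (hx : x ∈ powDomain A (2 * (k + 1))) :
    trapSum A δ t h (2 * (k + 1)) N x ∈ powDomain A (2 * (k + 1)) ∧
      trapApprox A δ t h (2 * (k + 1)) N x = trapSum A δ t h (2 * (k + 1)) N
        (shiftPow A (2 * (δ : ℂ)) (2 * (k + 1)) x) := by
  have hL : ∀ s : ℝ, _ := fun s => semigroupLaplace_mem_powDomain_and_shiftPow hK hM hA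
    (z := contourPoint δ s) (by rwa [contourPoint_re]) (2 * (δ : ℂ)) hx
  have hmem : ∀ j : ℤ, contourIntegrand A δ t (2 * (k + 1)) x (h * (j : ℝ)) ∈
      powDomain A (2 * (k + 1)) := by
    intro j
    rw [contourIntegrand_eq_smul_semigroupLaplace hK hM hA k hδ]
    exact smul_mem_powDomain _ (hL _).1
  obtain ⟨h1, h2⟩ := sum_mem_powDomain_and_shiftPow_sum (Finset.Icc (-(N : ℤ)) N)
    (2 * (δ : ℂ)) hmem
  rw [trapApprox, trapSum, trapSum, ← Complex.coe_smul, ← Complex.coe_smul]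
  refine ⟨smul_mem_powDomain _ h1, ?_⟩
  rw [shiftPow_smul _ _ h1, h2]
  congr 1
  refine Finset.sum_congr rfl fun j _ => ?_
  rw [contourIntegrand_eq_smul_semigroupLaplace hK hM hA k hδ,
    contourIntegrand_eq_smul_semigroupLaplace hK hM hA k hδ, shiftPow_smul _ _ (hL _).1,
    (hL _).2]

end Truncation

theorem theorem3 {X : Type*} [NormedAddCommGroup X] [NormedSpace ℂ X] [CompleteSpace X]
    (A : X →ₗ.[ℂ] X) (K : ℝ → X →L[ℂ] X) (hK : IsC0Semigroup K) (hA : IsGeneratorOf A K)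
    (M : ℝ) (hM : 1 ≤ M) (hgrowth : HasGrowthBound K M 0)
    (m : ℕ) (hm2 : 2 ≤ m) (hmeven : Even m)
    (δ h t : ℝ) (hδ : 0 < δ) (hh : 0 < h) (ht : 0 < t)
    (x : X) (hx : x ∈ powDomain A m)
    (y : X) (hy : y = shiftPow A (2 * (δ : ℂ)) m x) :
    -- the resolvent exists on the right half-plane, the contour integral converges absolutely
    -- and represents the semigroup, and the infinite trapezoidal sum converges absolutely
    (∀ z : ℂ, 0 < z.re → z ∈ opResolventSet A) ∧
    Integrable (contourIntegrand A δ t m y) ∧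
    K t x = contourIntegral A δ t m y ∧
    Summable (fun k : ℤ => ‖contourIntegrand A δ t m y (h * (k : ℝ))‖) ∧
    -- discretization error
    ‖contourIntegral A δ t m y - trapSeries A δ t h m y‖ ≤ discretizationBound M δ t h m ‖y‖ ∧
    (∀ N : ℕ, 1 ≤ N →
      -- the approximation is well defined and its error splits into the two contributions
      trapSum A δ t h m N x ∈ powDomain A m ∧
      trapApprox A δ t h m N x = trapSum A δ t h m N y ∧
      ‖K t x - trapApprox A δ t h m N x‖ ≤
        ‖contourIntegral A δ t m y - trapSeries A δ t h m y‖ +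
          ‖trapSeries A δ t h m y - trapSum A δ t h m N y‖ ∧
      -- truncation error
      ‖trapSeries A δ t h m y - trapSum A δ t h m N y‖ ≤ truncationBound M δ t h m N ‖y‖) ∧
    -- rate of convergence as the number of nodes grows
    (fun N : ℕ => truncationBound M δ t h m N ‖y‖) ~[atTop]
      (fun N : ℕ => M * Real.exp (δ * t) / (Real.pi * δ ^ m) *
        (1 / ((m : ℝ) - 1) * (δ / (h * (N : ℝ))) ^ (m - 1)) * ‖y‖) ∧
    (fun N : ℕ => trapSeries A δ t h m y - trapSum A δ t h m N y) =O[atTop]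
      (fun N : ℕ => ((N : ℝ) ^ (m - 1))⁻¹) := by
  obtain ⟨p, hp⟩ := hmeven
  -- Evenness makes |r(δ + is)| = (δ² + s²)^{-(k+1)} an integer power, and m/2 = k + 1 a natural
  -- parameter of ₂F₁.
  obtain ⟨k, rfl⟩ : ∃ k, m = 2 * (k + 1) := ⟨p - 1, by omega⟩
  subst hy
  set y := shiftPow A (2 * (δ : ℂ)) (2 * (k + 1)) x
  have hI : K t x = contourIntegral A δ t (2 * (k + 1)) y :=
    (contourIntegral_eq_semigroup hK hgrowth hA k hδ ht.le hx).symm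
  have hT := norm_trapSeries_sub_trapSum_le hK hgrowth hA k hδ hh t y
  have hE := truncationBound_isEquivalent M t hδ hh k ‖y‖
  refine ⟨fun z hz => mem_opResolventSet_of_re_pos hK hgrowth hz hA,
    integrable_contourIntegrand hK hgrowth hA k hδ t y, hI,
    summable_norm_contourIntegrand hK hgrowth hA k hδ hh t y, ?_, fun N _ => ?_, hE, ?_⟩
  · rw [discretizationBound_eq]
    exact norm_contourIntegral_sub_trapSeries_le hK hgrowth hA k hδ hh
      (summable_int_inv_sq_add_sq_pow k hδ hh) ht.le y
  · obtain ⟨h1, h2⟩ := trapSum_mem_powDomain_and_trapApprox hK hgrowth hA k hδ t N hx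
    refine ⟨h1, h2, ?_, hT N⟩
    rw [h2, hI]
    exact norm_sub_le_norm_sub_add_norm_sub _ _ _
  · refine (IsBigO.of_bound' (Eventually.of_forall fun N =>
      (hT N).trans (Real.le_norm_self _))).trans (hE.isBigO.trans ?_)
    refine (isBigO_const_mul_self (M * Real.exp (δ * t) / (Real.pi * δ ^ (2 * (k + 1))) *
      (1 / (((2 * (k + 1) : ℕ) : ℝ) - 1) * (δ / h) ^ (2 * (k + 1) - 1)) * ‖y‖)
      (fun N : ℕ => ((N : ℝ) ^ (2 * (k + 1) - 1))⁻¹) atTop).congr_left fun N => ?_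
    rw [← div_div δ h, div_pow (δ / h)]
    ring
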